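/- Let $n\ge 1$, $m\ge 2$, and let $P\subset\mathbb{R}^{n+m}$ be a (necessarily full-dimensional) polytope with the origin in its interior. Let its facets be given by the equations $\ell_1(x)=a_1,\dots,\ell_d(x)=a_d$ with $\ell_i$ linear, one for each facet, and put $\tilde p(x,w)=\prod_{i=1}^d(\ell_i(x)-a_iw)$. The first puffed polytope $P^{(1)}$ is the closure of the connected component of the origin in $\mathbb{R}^{n+m}\setminus Z_1$, where $Z_1=\{x:\frac{\partial\tilde p}{\partial w}(x,1)=0\}$. Assume that $P^{(1)}$ is bounded, i.e. that it is a convex body. Let $V\subset\mathbb{R}^{n+m}$ be any linear subspace of dimension $n$, $W=V^\perp$, and let $\pi:\mathbb{R}^{n+m}\to V$ be the orthogonal projection. For a convex body $K\subset \mathbb{R}^{n+m}$ and $x\in\pi(K)$ let $K_x=\{y\in W: x+y\in K\}$. The fiber body of $K$ is $$\Sigma_\pi(K)=\Big\{\int_{\pi(K)}\gamma(x)\,dx \;:\; \gamma:\pi(K)\to W \text{ Borel measurable},\ \gamma(x)\in K_x \text{ for all } x\in\pi(K)\Big\}\subset W,$$ where $dx$ is the $n$-dimensional Lebesgue measure on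 $V$. A convex body $L\subset W$ is called strictly convex if for every $u\in W\setminus\{0\}$ the linear form $\langle u,\cdot\rangle$ attains its maximum on $L$ at exactly one point. Then $\Sigma_\pi(P^{(1)})$ is strictly convex if and only if $m=2$. -/

import Mathlib

open scoped InnerProductSpace Polynomial

noncomputable section

namespace PuffedFiber

variable {E : Type*} [NormedAddCommGroup E] [InnerProductSpace ℝ E]

/-- A polytope: the convex hull of a finite set of points. -/
def IsPolytope (P : Set E) : Prop :=
  ∃ S : Set E, S.Finite ∧ P = convexHull ℝ S

/-- The part of `P` on the hyperplane `⟨a, x⟩ = 1`. -/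
def hyperplaneSection (P : Set E) (a : E) : Set E :=
  {x ∈ P | ⟪a, x⟫_ℝ = 1}

/-- The normalized facet normals of `P`, for `P` with the origin in its interior: the vectors `a`
such that `⟨a, x⟩ ≤ 1` is valid on `P` and `{x ∈ P | ⟨a, x⟩ = 1}` is a facet, that is, a face of
dimension `dim E - 1`. No facet hyperplane passes through the origin, so each facet has exactly one
equation `⟨a, x⟩ = 1`; other equations of the same facet are its nonzero multiples, and change the
product below only by a nonzero constant factor. -/
def facetNormals (P : Set E) : Set E :=
  {a | (∀ x ∈ P, ⟪a, x⟫_ℝ ≤ 1) ∧ (hyperplaneSection P a).Nonempty ∧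
    Module.finrank ℝ (vectorSpan ℝ (hyperplaneSection P a)) + 1 = Module.finrank ℝ E}

/-- The homogenized facet polynomial `∏ (⟨a, x⟩ - w)`, over the facets `⟨a, ·⟩ = 1` of `P`,
as a polynomial in the homogenizing variable `w` for each fixed `x`. -/
def homogenizedPoly (P : Set E) (x : E) : ℝ[X] :=
  ∏ᶠ a ∈ facetNormals P, (Polynomial.C ⟪a, x⟫_ℝ - Polynomial.X)

/-- The zero locus in `E` of the `i`-th derivative in `w` of the homogenized facet polynomial,
evaluated at `w = 1`. -/
def derivZeroLocus (i : ℕ) (P : Set E) : Set E :=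
  {x | (Polynomial.derivative^[i] (homogenizedPoly P x)).eval 1 = 0}

/-- The `i`-th puffed polytope: the closure of the connected component of the origin in the
complement of `derivZeroLocus i P`. -/
def puffed (i : ℕ) (P : Set E) : Set E :=
  closure (connectedComponentIn (derivZeroLocus i P)ᶜ 0)

/-- The face of `K` in direction `u`: the points of `K` that maximize `⟨u, ·⟩` on `K`. -/
def faceInDirection (K : Set E) (u : E) : Set E :=
  {y ∈ K | ∀ z ∈ K, ⟪u, z⟫_ℝ ≤ ⟪u, y⟫_ℝ}

/-- Strict convexity of a convex body: the face in every direction is a single point. -/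
def IsStrictlyConvexBody (K : Set E) : Prop :=
  ∀ u : E, u ≠ 0 → ∃ y : E, faceInDirection K u = {y}

variable [FiniteDimensional ℝ E]

/-- The image of `K` under the orthogonal projection onto `V`. -/
def projImage (V : Submodule ℝ E) (K : Set E) : Set V :=
  V.orthogonalProjectionOnto '' K

/-- The fiber `K_x = {y ∈ W | (x, y) ∈ K}` over `x ∈ V`, where `W` is the orthogonal complement
of `V`, and `(x, y)` is the vector `x + y` of `V ⊕ W`. -/
def fiber (V : Submodule ℝ E) (K : Set E) (x : V) : Set Vᗮ :=
  {y | (x : E) + (y : E) ∈ K}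

variable [MeasurableSpace E] [BorelSpace E]

/-- The `dim V`-dimensional Lebesgue measure on the Euclidean space `V`: the translation invariant
measure that gives volume one to the cube spanned by an orthonormal basis. (The subspace `V` must
not be given the restriction of the Lebesgue measure of `E`, which is zero.) -/
def lebesgueOn (V : Submodule ℝ E) : MeasureTheory.Measure V :=
  (stdOrthonormalBasis ℝ V).toBasis.addHaar

/-- The fiber body of a convex body `K` with respect to the orthogonal projection onto `V`: the
integrals over the projection of `K` of the Borel measurable sections `γ`. Only the values of `γ`
on the projection of `K`, a compact set, matter. -/
def fiberBody (V : Submodule ℝ E) (K : Set E) : Set Vᗮ :=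
  {y | ∃ γ : V → Vᗮ, Measurable γ ∧ (∀ x ∈ projImage V K, γ x ∈ fiber V K x) ∧
    y = ∫ x in projImage V K, γ x ∂(lebesgueOn V)}

end PuffedFiber

end

/-! Write `l_a(x) = 1 - ⟪a, x⟫` for the slacks of the `d` facets. Up to sign, the derivative in `w`
at `w = 1` is the elementary symmetric polynomial `e_{d-1}` of the slacks. The component of the
origin is the region where `e_{d-1} > 0` and at most one slack is nonpositive
(`connectedComponentIn_coEsymm_ne_zero`). On its closure any two slacks have nonnegative sum.

Two facts about the puffed polytope follow. A segment in it that misses the open region lies in `⟪a,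
·⟫ = ⟪b, ·⟫ = 1` for two distinct facet normals (`exists_inRegion_segment_or_active`). Conversely
`⟪a + b, ·⟫ ≤ 2` is valid on it, so points of `P` common to both facets maximize `a + b`.

By measurable selection, the fiber body is strictly convex iff, for each `u ≠ 0`, the face in
direction `u` of almost every fiber is a single point.

If `m = 2`, fibers meeting `⟪a, ·⟫ = ⟪b, ·⟫ = 1` in two points lie over a hyperplane of `V`, and
there are finitely many pairs. If `m ≥ 3`, over every point near the origin some codimension two
face of `P` has a fiber with two points. One pair therefore serves a set of positive measure, and `a
+ b` gives a direction where strict convexity fails. -/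

namespace PuffedFiber

/-! ### Measurable selection by lexicographic maximization. -/

open MeasureTheory Filter Topology

/-- The maximizers of `f` on `A`. -/
def argmaxSet {Y : Type*} (A : Set Y) (f : Y → ℝ) : Set Y :=
  {y ∈ A | ∀ z ∈ A, f z ≤ f y}

/-- A compact-valued multifunction whose hitting sets of closed sets are measurable. -/
structure MeasurableCompact {X Y : Type*} [MeasurableSpace X] [TopologicalSpace Y]
    (S : X → Set Y) : Prop where
  isCompact : ∀ x, IsCompact (S x)
  measurableSet_hits : ∀ D : Set Y, IsClosed D → MeasurableSet {x | (S x ∩ D).Nonempty}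

section Selection

variable {X Y : Type*} [MeasurableSpace X] [TopologicalSpace Y]

theorem argmaxSet_nonempty {A : Set Y} (hA : IsCompact A) (hne : A.Nonempty) {f : Y → ℝ}
    (hf : Continuous f) : (argmaxSet A f).Nonempty := by
  obtain ⟨y, hy, h⟩ := hA.exists_isMaxOn hne hf.continuousOn
  exact ⟨y, hy, fun z hz => h hz⟩

theorem isCompact_argmaxSet {A : Set Y} (hA : IsCompact A) {f : Y → ℝ}
    (hf : Continuous f) : IsCompact (argmaxSet A f) := by
  have : argmaxSet A f = A ∩ ⋂ z ∈ A, {y | f z ≤ f y} := by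
    ext y; simp [argmaxSet]
  rw [this]
  exact hA.inter_right (isClosed_biInter fun z _ => isClosed_le continuous_const hf)

/-- If the maximum over `A ∩ D` is below the one over `A`, a rational level separates them. This
turns the hitting condition for the argmax into countably many hitting conditions for `A`, so
measurability survives maximization. -/
theorem argmaxSet_inter_nonempty_iff {A D : Set Y} (hA : IsCompact A) (hD : IsClosed D)
    {f : Y → ℝ} (hf : Continuous f) :
    (argmaxSet A f ∩ D).Nonempty ↔ (A ∩ D).Nonempty ∧
      ∀ q : ℚ, (A ∩ {y | (q : ℝ) ≤ f y}).Nonempty → (A ∩ (D ∩ {y | (q : ℝ) ≤ f y})).Nonempty := by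
  constructor
  · rintro ⟨y, hy, hyD⟩
    refine ⟨⟨y, hy.1, hyD⟩, ?_⟩
    rintro q ⟨z, hz, hqz⟩
    exact ⟨y, hy.1, hyD, le_trans hqz (hy.2 z hz)⟩
  · rintro ⟨hne, h⟩
    obtain ⟨y, hy, hmax⟩ := argmaxSet_nonempty (hA.inter_right hD) hne hf
    refine ⟨y, ⟨hy.1, fun z hz => ?_⟩, hy.2⟩
    by_contra! hlt
    obtain ⟨q, hq1, hq2⟩ := exists_rat_btwn hlt
    obtain ⟨z', hz'A, hz'D, hz'⟩ := h q ⟨z, hz, hq2.le⟩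
    exact absurd (hmax z' ⟨hz'A, hz'D⟩) (not_le.2 (lt_of_lt_of_le hq1 hz'))

theorem MeasurableCompact.argmaxSet {S : X → Set Y} (hS : MeasurableCompact S) {f : Y → ℝ}
    (hf : Continuous f) : MeasurableCompact fun x => argmaxSet (S x) f := by
  refine ⟨fun x => isCompact_argmaxSet (hS.isCompact x) hf, fun D hD => ?_⟩
  simp_rw [fun x => argmaxSet_inter_nonempty_iff (hS.isCompact x) hD hf, Set.ofPred_and,
    Set.ofPred_forall]
  refine (hS.measurableSet_hits D hD).inter (MeasurableSet.iInter fun q => ?_)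
  have hc : IsClosed {y | (q : ℝ) ≤ f y} := isClosed_le continuous_const hf
  simp_rw [imp_iff_not_or]
  exact (hS.measurableSet_hits _ hc).compl.union (hS.measurableSet_hits _ (hD.inter hc))

theorem MeasurableCompact.exists_refinement {S : X → Set Y} (hS : MeasurableCompact S)
    (L : List (Y → ℝ)) (hL : ∀ f ∈ L, Continuous f) :
    ∃ T : X → Set Y, MeasurableCompact T ∧ (∀ x, T x ⊆ S x) ∧
      (∀ x, (S x).Nonempty → (T x).Nonempty) ∧
      ∀ f ∈ L, ∀ x, ∀ y ∈ T x, ∀ z ∈ T x, f y = f z := by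
  induction L with
  | nil => exact ⟨S, hS, fun _ => subset_rfl, fun _ h => h, by simp⟩
  | cons f L ih =>
    obtain ⟨T, hT, hTS, hTne, hTL⟩ := ih fun g hg => hL g (List.mem_cons_of_mem _ hg)
    have hf := hL f List.mem_cons_self
    refine ⟨_, hT.argmaxSet hf, fun x y hy => hTS x hy.1,
      fun x hx => argmaxSet_nonempty (hT.isCompact x) (hTne x hx) hf, ?_⟩
    intro g hg x y hy z hz
    rcases List.mem_cons.1 hg with rfl | hg
    · exact le_antisymm (hz.2 y hy.1) (hy.2 z hz.1)
    · exact hTL g hg x y hy.1 z hz.1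

/-- Maximizing the coordinates of an orthonormal basis one after another shrinks each nonempty value
to a single point. -/
theorem MeasurableCompact.exists_measurable_selection {Y : Type*} [NormedAddCommGroup Y]
    [InnerProductSpace ℝ Y] [FiniteDimensional ℝ Y] [MeasurableSpace Y] [BorelSpace Y]
    {S : X → Set Y} (hS : MeasurableCompact S) :
    ∃ γ : X → Y, Measurable γ ∧ ∀ x, (S x).Nonempty → γ x ∈ S x := by
  classical
  let b := stdOrthonormalBasis ℝ Y
  obtain ⟨T, hT, hTS, hTne, hTL⟩ := hS.exists_refinement
    (List.ofFn fun i => fun y => ⟪b i, y⟫_ℝ) (by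
      intro f hf
      obtain ⟨i, rfl⟩ := List.mem_ofFn.1 hf
      fun_prop)
  have huniq : ∀ x, ∀ y ∈ T x, ∀ z ∈ T x, y = z := fun x y hy z hz =>
    b.repr.injective <| by
      ext i
      simpa [b.repr_apply_apply] using hTL _ (List.mem_ofFn.2 ⟨i, rfl⟩) x y hy z hz
  let γ : X → Y := fun x => if h : (T x).Nonempty then h.some else 0
  have hγ : ∀ x, (T x).Nonempty → γ x ∈ T x := fun x h => by
    simp only [γ, dif_pos h]; exact h.some_mem
  refine ⟨γ, measurable_of_isClosed fun D hD => ?_, fun x hx => hTS x (hγ x (hTne x hx))⟩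
  have hE : MeasurableSet {x | (T x).Nonempty} := by
    simpa using hT.measurableSet_hits Set.univ isClosed_univ
  -- The second piece accounts for the default value `0` where `T x` is empty.
  have : γ ⁻¹' D = {x | (T x ∩ D).Nonempty} ∪ ({x | (T x).Nonempty}ᶜ ∩ {_x | (0 : Y) ∈ D}) := by
    ext x
    by_cases h : (T x).Nonempty
    · have h1 := hγ x h
      simp only [Set.mem_preimage, Set.mem_union, Set.mem_ofPred_eq, Set.mem_inter_iff,
        Set.mem_compl_iff, h, not_true, false_and, or_false]
      exact ⟨fun hD => ⟨_, h1, hD⟩, fun ⟨y, hy, hyD⟩ => huniq x y hy _ h1 ▸ hyD⟩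
    · have h' : ¬ (T x ∩ D).Nonempty := fun ⟨y, hy, _⟩ => h ⟨y, hy⟩
      simp [γ, h, h']
  rw [this]
  exact (hT.measurableSet_hits D hD).union (hE.compl.inter (MeasurableSet.const _))

end Selection

/-! ### Faces of the fiber body through faces of the fibers. -/

section FiberBody

variable {E : Type*} [NormedAddCommGroup E] [InnerProductSpace ℝ E] [FiniteDimensional ℝ E]
  {V : Submodule ℝ E} {K : Set E}

theorem proj_add_eq (x : V) (y : Vᗮ) :
    V.orthogonalProjectionOnto ((x : E) + y) = x := by
  rw [map_add, Submodule.orthogonalProjectionOnto_mem_subspace_eq_self,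
    Submodule.orthogonalProjectionOnto_apply_of_mem_orthogonal y.2, add_zero]

theorem proj_add_projOrth_eq (z : E) :
    ((V.orthogonalProjectionOnto z : V) : E) + (Vᗮ.orthogonalProjectionOnto z : Vᗮ) = z :=
  V.starProjection_add_starProjection_orthogonal z

theorem fiber_nonempty_iff {x : V} : (fiber V K x).Nonempty ↔ x ∈ projImage V K := by
  constructor
  · rintro ⟨y, hy⟩
    exact ⟨_, hy, proj_add_eq x y⟩
  · rintro ⟨z, hz, rfl⟩
    refine ⟨Vᗮ.orthogonalProjectionOnto z, ?_⟩
    change _ ∈ K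
    rwa [proj_add_projOrth_eq]

theorem isClosedEmbedding_add_orth (x : V) :
    IsClosedEmbedding fun y : Vᗮ => (x : E) + (y : E) :=
  (Homeomorph.addLeft (x : E)).isClosedEmbedding.comp
    (Submodule.closed_of_finiteDimensional Vᗮ).isClosedEmbedding_subtypeVal

theorem isCompact_fiber (hK : IsCompact K) (x : V) : IsCompact (fiber V K x) :=
  (isClosedEmbedding_add_orth x).isCompact_preimage hK

theorem isCompact_projImage (hK : IsCompact K) : IsCompact (projImage V K) :=
  hK.image V.orthogonalProjectionOnto.continuous

variable [MeasurableSpace E] [BorelSpace E]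

/-- A hitting set is the projection of a compact part of `K`, hence compact. -/
theorem measurableCompact_fiber (hK : IsCompact K) : MeasurableCompact (fiber V K) := by
  refine ⟨isCompact_fiber hK, fun D hD => ?_⟩
  have : {x | (fiber V K x ∩ D).Nonempty} =
      V.orthogonalProjectionOnto '' (K ∩ Vᗮ.orthogonalProjectionOnto ⁻¹' D) := by
    ext x
    constructor
    · rintro ⟨y, hy, hyD⟩
      refine ⟨(x : E) + y, ⟨hy, ?_⟩, proj_add_eq x y⟩
      have : Vᗮ.orthogonalProjectionOnto ((x : E) + y) = y := by
        have h := proj_add_projOrth_eq (V := V) ((x : E) + y)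
        rw [proj_add_eq] at h
        exact Subtype.ext (add_left_cancel h)
      simpa [this] using hyD
    · rintro ⟨z, ⟨hz, hzD⟩, rfl⟩
      refine ⟨_, ?_, hzD⟩
      change _ ∈ K
      rwa [proj_add_projOrth_eq]
  rw [this]
  exact ((hK.inter_right (hD.preimage (ContinuousLinearMap.continuous _))).image
    (ContinuousLinearMap.continuous _)).measurableSet

instance : (lebesgueOn V).IsAddHaarMeasure := by
  unfold lebesgueOn; infer_instance

theorem integrableOn_section (hK : IsCompact K) {γ : V → Vᗮ} (hγ : Measurable γ)
    (hγK : ∀ x ∈ projImage V K, γ x ∈ fiber V K x) :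
    Integrable γ ((lebesgueOn V).restrict (projImage V K)) := by
  obtain ⟨R, hR⟩ := hK.isBounded.exists_norm_le
  have hcomp := isCompact_projImage (V := V) hK
  refine Measure.integrableOn_of_bounded (M := R) hcomp.measure_lt_top.ne
    hγ.aestronglyMeasurable ?_
  refine (ae_restrict_iff' hcomp.measurableSet).2 (ae_of_all _ fun x hx => ?_)
  have h1 := hR _ (hγK x hx)
  have h2 : ‖(x : E)‖ * ‖(x : E)‖ + ‖(γ x : E)‖ * ‖(γ x : E)‖ =
      ‖(x : E) + γ x‖ * ‖(x : E) + γ x‖ :=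
    (norm_add_sq_eq_norm_sq_add_norm_sq_of_inner_eq_zero _ _
      (Submodule.inner_right_of_mem_orthogonal x.2 (γ x).2)).symm
  have h3 : ‖(γ x : E)‖ ≤ ‖(x : E) + γ x‖ :=
    (mul_self_le_mul_self_iff (norm_nonneg _) (norm_nonneg _)).2
      (by nlinarith [mul_self_nonneg ‖(x : E)‖])
  exact h3.trans h1

theorem inner_setIntegral_section (hK : IsCompact K) {γ : V → Vᗮ} (hγ : Measurable γ)
    (hγK : ∀ x ∈ projImage V K, γ x ∈ fiber V K x) (u : Vᗮ) :
    ⟪u, ∫ x in projImage V K, γ x ∂(lebesgueOn V)⟫_ℝ =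
      ∫ x in projImage V K, ⟪u, γ x⟫_ℝ ∂(lebesgueOn V) :=
  (integral_inner (integrableOn_section hK hγ hγK) u).symm

theorem mem_faceInDirection_fiberBody (hK : IsCompact K) {γ : V → Vᗮ} (hγ : Measurable γ)
    {u : Vᗮ} (hγK : ∀ x ∈ projImage V K, γ x ∈ faceInDirection (fiber V K x) u) :
    ∫ x in projImage V K, γ x ∂(lebesgueOn V) ∈ faceInDirection (fiberBody V K) u := by
  have hγ' : ∀ x ∈ projImage V K, γ x ∈ fiber V K x := fun x hx => (hγK x hx).1
  refine ⟨⟨γ, hγ, hγ', rfl⟩, ?_⟩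
  rintro _ ⟨δ, hδ, hδK, rfl⟩
  rw [inner_setIntegral_section hK hγ hγ', inner_setIntegral_section hK hδ hδK]
  exact setIntegral_mono_on ((integrableOn_section hK hδ hδK).const_inner u)
    ((integrableOn_section hK hγ hγ').const_inner u) (isCompact_projImage hK).measurableSet
    fun x hx => (hγK x hx).2 _ (hδK x hx)

/-- Inside the face in direction `u`, select once a maximizer and once a minimizer of `v`. Both
integrals lie in the same one-point face, so the two ordered integrands agree almost everywhere.
Letting `v` run through a basis pins the face to a point. -/
theorem ae_subsingleton_face_of_isStrictlyConvexBody (hK : IsCompact K)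
    (h : IsStrictlyConvexBody (fiberBody V K)) {u : Vᗮ} (hu : u ≠ 0) :
    ∀ᵐ x ∂(lebesgueOn V).restrict (projImage V K),
      (faceInDirection (fiber V K x) u).Subsingleton := by
  let b := stdOrthonormalBasis ℝ Vᗮ
  have hS := measurableCompact_fiber (V := V) hK
  have hcu : Continuous fun y : Vᗮ => ⟪u, y⟫_ℝ := by fun_prop
  have hF := hS.argmaxSet hcu
  have key : ∀ v : Vᗮ, ∀ᵐ x ∂(lebesgueOn V).restrict (projImage V K),
      ∀ y ∈ faceInDirection (fiber V K x) u, ∀ z ∈ faceInDirection (fiber V K x) u,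
        ⟪v, y⟫_ℝ = ⟪v, z⟫_ℝ := by
    intro v
    have hc1 : Continuous fun y : Vᗮ => ⟪v, y⟫_ℝ := by fun_prop
    have hc2 : Continuous fun y : Vᗮ => -⟪v, y⟫_ℝ := by fun_prop
    obtain ⟨γ, hγ, hγS⟩ := (hF.argmaxSet hc1).exists_measurable_selection
    obtain ⟨δ, hδ, hδS⟩ := (hF.argmaxSet hc2).exists_measurable_selection
    have hne : ∀ x ∈ projImage V K, (argmaxSet (fiber V K x) fun y => ⟪u, y⟫_ℝ).Nonempty :=
      fun x hx => argmaxSet_nonempty (hS.isCompact x) (fiber_nonempty_iff.2 hx) hcu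
    have hγm : ∀ x ∈ projImage V K, γ x ∈ argmaxSet
        (argmaxSet (fiber V K x) fun y => ⟪u, y⟫_ℝ) fun y => ⟪v, y⟫_ℝ := fun x hx =>
      hγS x (argmaxSet_nonempty (hF.isCompact x) (hne x hx) hc1)
    have hδm : ∀ x ∈ projImage V K, δ x ∈ argmaxSet
        (argmaxSet (fiber V K x) fun y => ⟪u, y⟫_ℝ) fun y => -⟪v, y⟫_ℝ := fun x hx =>
      hδS x (argmaxSet_nonempty (hF.isCompact x) (hne x hx) hc2)
    have h1 := mem_faceInDirection_fiberBody hK hγ fun x hx => (hγm x hx).1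
    have h2 := mem_faceInDirection_fiberBody hK hδ fun x hx => (hδm x hx).1
    obtain ⟨y, hy⟩ := h u hu
    rw [hy] at h1 h2
    have hγK : ∀ x ∈ projImage V K, γ x ∈ fiber V K x := fun x hx => (hγm x hx).1.1
    have hδK : ∀ x ∈ projImage V K, δ x ∈ fiber V K x := fun x hx => (hδm x hx).1.1
    have h3 : ∫ x in projImage V K, ⟪v, δ x⟫_ℝ ∂(lebesgueOn V) =
        ∫ x in projImage V K, ⟪v, γ x⟫_ℝ ∂(lebesgueOn V) := by
      rw [← inner_setIntegral_section hK hγ hγK, ← inner_setIntegral_section hK hδ hδK,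
        Set.mem_singleton_iff.1 h1, Set.mem_singleton_iff.1 h2]
    have hmeas := (isCompact_projImage (V := V) hK).measurableSet
    have h4 := (integral_eq_iff_of_ae_le ((integrableOn_section hK hδ hδK).const_inner v)
      ((integrableOn_section hK hγ hγK).const_inner v)
      ((ae_restrict_iff' hmeas).2 (ae_of_all _ fun x hx =>
        (hγm x hx).2 _ (hδm x hx).1))).1 h3
    filter_upwards [h4, ae_restrict_mem hmeas] with x hx hxm y hy z hz
    have e1 := (hγm x hxm).2 y hy
    have e2 := (hγm x hxm).2 z hz
    have e3 := (hδm x hxm).2 y hy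
    have e4 := (hδm x hxm).2 z hz
    simp only at hx e1 e2 e3 e4
    linarith
  filter_upwards [ae_all_iff.2 fun i => key (b i)] with x hx y hy z hz
  refine b.repr.injective ?_
  ext i
  simpa [b.repr_apply_apply] using hx i y hy z hz

/-- A section whose integral is maximal must maximize `u` in almost every fiber, which determines it
almost everywhere. -/
theorem isStrictlyConvexBody_of_ae_subsingleton_face (hK : IsCompact K)
    (h : ∀ u : Vᗮ, u ≠ 0 → ∀ᵐ x ∂(lebesgueOn V).restrict (projImage V K),
      (faceInDirection (fiber V K x) u).Subsingleton) :
    IsStrictlyConvexBody (fiberBody V K) := by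
  intro u hu
  have hS := measurableCompact_fiber (V := V) hK
  have hcu : Continuous fun y : Vᗮ => ⟪u, y⟫_ℝ := by fun_prop
  obtain ⟨γ, hγ, hγS⟩ := (hS.argmaxSet hcu).exists_measurable_selection
  have hγm : ∀ x ∈ projImage V K, γ x ∈ faceInDirection (fiber V K x) u := fun x hx =>
    hγS x (argmaxSet_nonempty (hS.isCompact x) (fiber_nonempty_iff.2 hx) hcu)
  have hγK : ∀ x ∈ projImage V K, γ x ∈ fiber V K x := fun x hx => (hγm x hx).1
  have hmem := mem_faceInDirection_fiberBody hK hγ hγm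
  refine ⟨_, Set.eq_singleton_iff_unique_mem.2 ⟨hmem, ?_⟩⟩
  rintro _ ⟨⟨δ, hδ, hδK, rfl⟩, hmax⟩
  have hmeas := (isCompact_projImage (V := V) hK).measurableSet
  have h3 := le_antisymm (hmem.2 _ ⟨δ, hδ, hδK, rfl⟩) (hmax _ hmem.1)
  rw [inner_setIntegral_section hK hγ hγK, inner_setIntegral_section hK hδ hδK] at h3
  have h4 := (integral_eq_iff_of_ae_le ((integrableOn_section hK hδ hδK).const_inner u)
    ((integrableOn_section hK hγ hγK).const_inner u)
    ((ae_restrict_iff' hmeas).2 (ae_of_all _ fun x hx =>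
      (hγm x hx).2 _ (hδK x hx)))).1 h3
  refine integral_congr_ae ?_
  filter_upwards [h4, ae_restrict_mem hmeas, h u hu] with x hx hxm hsub
  refine hsub ⟨hδK x hxm, fun z hz => ?_⟩ (hγm x hxm)
  exact ((hγm x hxm).2 z hz).trans (le_of_eq hx.symm)

end FiberBody

end PuffedFiber

namespace PuffedFiber

/-! ### The region of `e_{d-1}` in the space of slacks. -/

section ElementarySymmetric

variable {ι : Type*} [DecidableEq ι]

/-- The elementary symmetric polynomial of degree `s.card - 1` in the values of `l` on `s`. -/
def coEsymm (s : Finset ι) (l : ι → ℝ) : ℝ :=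
  ∑ a ∈ s, ∏ b ∈ s.erase a, l b

/-- An explicit description of the hyperbolicity region of `coEsymm`. -/
def InRegion (s : Finset ι) (l : ι → ℝ) : Prop :=
  0 < coEsymm s l ∧ ∀ a ∈ s, ∀ b ∈ s, a ≠ b → 0 < l a ∨ 0 < l b

variable {s : Finset ι} {l : ι → ℝ} {a : ι}

/-- When all values but `l a` are positive, the sign is that of `1 + l a * ∑ (l b)⁻¹`; all later
estimates use this form. -/
theorem coEsymm_eq_mul (ha : a ∈ s) (h : ∀ b ∈ s.erase a, 0 < l b) :
    coEsymm s l = (∏ b ∈ s.erase a, l b) * (1 + l a * ∑ b ∈ s.erase a, (l b)⁻¹) := by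
  rw [coEsymm, ← Finset.add_sum_erase s _ ha, mul_add, mul_one, Finset.mul_sum, Finset.mul_sum]
  congr 1
  refine Finset.sum_congr rfl fun b hb => ?_
  have hab : a ∈ s.erase b := Finset.mem_erase.2 ⟨(Finset.ne_of_mem_erase hb).symm, ha⟩
  rw [← Finset.mul_prod_erase _ _ hab, ← Finset.mul_prod_erase _ _ hb, Finset.erase_right_comm]
  have := (h b hb).ne'
  field_simp

theorem coEsymm_pos_iff (ha : a ∈ s) (h : ∀ b ∈ s.erase a, 0 < l b) :
    0 < coEsymm s l ↔ 0 < 1 + l a * ∑ b ∈ s.erase a, (l b)⁻¹ := by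
  rw [coEsymm_eq_mul ha h]
  exact mul_pos_iff_of_pos_left (Finset.prod_pos h)

theorem coEsymm_nonneg_iff (ha : a ∈ s) (h : ∀ b ∈ s.erase a, 0 < l b) :
    0 ≤ coEsymm s l ↔ 0 ≤ 1 + l a * ∑ b ∈ s.erase a, (l b)⁻¹ := by
  rw [coEsymm_eq_mul ha h]
  exact mul_nonneg_iff_of_pos_left (Finset.prod_pos h)

theorem inRegion_of_pos_erase (ha : a ∈ s) (h : ∀ b ∈ s.erase a, 0 < l b)
    (hpos : 0 < 1 + l a * ∑ b ∈ s.erase a, (l b)⁻¹) : InRegion s l := by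
  refine ⟨(coEsymm_pos_iff ha h).2 hpos, fun b hb c hc hbc => ?_⟩
  by_cases hba : b = a
  · exact Or.inr (h c (Finset.mem_erase.2 ⟨fun hca => hbc (hba.trans hca.symm), hc⟩))
  · exact Or.inl (h b (Finset.mem_erase.2 ⟨hba, hb⟩))

theorem sum_inv_erase_nonneg (h : ∀ b ∈ s.erase a, 0 < l b) :
    0 ≤ ∑ b ∈ s.erase a, (l b)⁻¹ :=
  Finset.sum_nonneg fun b hb => (inv_pos.2 (h b hb)).le

theorem inRegion_of_nonneg (ha : a ∈ s) (h : ∀ b ∈ s.erase a, 0 < l b) (hla : 0 ≤ l a) :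
    InRegion s l :=
  inRegion_of_pos_erase ha h (by have := mul_nonneg hla (sum_inv_erase_nonneg h); linarith)

theorem InRegion.exists_erase_pos (hs : s.Nonempty) (h : InRegion s l) :
    ∃ a ∈ s, ∀ b ∈ s.erase a, 0 < l b := by
  by_cases hall : ∀ b ∈ s, 0 < l b
  · obtain ⟨a, ha⟩ := hs
    exact ⟨a, ha, fun b hb => hall b (Finset.mem_of_mem_erase hb)⟩
  · push Not at hall
    obtain ⟨a, ha, hla⟩ := hall
    refine ⟨a, ha, fun b hb => ?_⟩
    obtain ⟨hba, hb⟩ := Finset.mem_erase.1 hb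
    exact (h.2 a ha b hb hba.symm).resolve_left hla.not_gt

/-- Star-shapedness about the all-ones vector, the slack vector of the origin. -/
theorem InRegion.segment (hs : s.Nonempty) (h : InRegion s l) {t : ℝ} (ht0 : 0 ≤ t)
    (ht1 : t ≤ 1) : InRegion s fun b => (1 - t) + t * l b := by
  rcases ht0.eq_or_lt with rfl | ht0
  · obtain ⟨a, ha⟩ := hs
    exact inRegion_of_nonneg ha (by simp) (by simp)
  obtain ⟨a, ha, hpos⟩ := h.exists_erase_pos hs
  have hpos' : ∀ b ∈ s.erase a, 0 < (1 - t) + t * l b := fun b hb => by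
    have := mul_pos ht0 (hpos b hb); linarith
  rcases le_or_gt 0 ((1 - t) + t * l a) with h0 | h0
  · exact inRegion_of_nonneg ha hpos' h0
  refine inRegion_of_pos_erase ha hpos' ?_
  have h1 := (coEsymm_pos_iff ha hpos).1 h.1
  have hla : t * l a ≤ (1 - t) + t * l a := by linarith
  have h2 : ∑ b ∈ s.erase a, ((1 - t) + t * l b)⁻¹ ≤ ∑ b ∈ s.erase a, (t * l b)⁻¹ :=
    Finset.sum_le_sum fun b hb =>
      inv_anti₀ (mul_pos ht0 (hpos b hb)) (by linarith)
  have h3 : ∑ b ∈ s.erase a, (t * l b)⁻¹ = t⁻¹ * ∑ b ∈ s.erase a, (l b)⁻¹ := by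
    rw [Finset.mul_sum]; exact Finset.sum_congr rfl fun b _ => mul_inv _ _
  have h4 := sum_inv_erase_nonneg hpos'
  have h5 : t * l a * ∑ b ∈ s.erase a, (t * l b)⁻¹ = l a * ∑ b ∈ s.erase a, (l b)⁻¹ := by
    rw [h3]; field_simp
  have h6 : (t * l a) * ∑ b ∈ s.erase a, (t * l b)⁻¹ ≤
      ((1 - t) + t * l a) * ∑ b ∈ s.erase a, ((1 - t) + t * l b)⁻¹ :=
    calc (t * l a) * ∑ b ∈ s.erase a, (t * l b)⁻¹
        ≤ (t * l a) * ∑ b ∈ s.erase a, ((1 - t) + t * l b)⁻¹ :=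
          mul_le_mul_of_nonpos_left h2 (by linarith)
      _ ≤ _ := mul_le_mul_of_nonneg_right hla h4
  linarith

/-- If `l a ≤ 0`, keeping only the term of `b` in the sum of reciprocals gives `-l a / l b < 1`. -/
theorem InRegion.add_nonneg (h : InRegion s l) {b : ι} (ha : a ∈ s) (hb : b ∈ s) (hab : a ≠ b) :
    0 ≤ l a + l b := by
  wlog hla : l a ≤ 0 generalizing a b
  · by_cases hlb : l b ≤ 0
    · rw [add_comm]; exact this hb ha hab.symm hlb
    · push Not at hla hlb; linarith
  have hpos : ∀ c ∈ s.erase a, 0 < l c := fun c hc =>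
    (h.2 a ha c (Finset.mem_of_mem_erase hc) (Finset.ne_of_mem_erase hc).symm).resolve_left
      hla.not_gt
  have h1 := (coEsymm_pos_iff ha hpos).1 h.1
  have hb' : b ∈ s.erase a := Finset.mem_erase.2 ⟨hab.symm, hb⟩
  have h2 : (l b)⁻¹ ≤ ∑ c ∈ s.erase a, (l c)⁻¹ :=
    Finset.single_le_sum (f := fun c => (l c)⁻¹) (fun c hc => (inv_pos.2 (hpos c hc)).le) hb'
  have h3 := mul_le_mul_of_nonpos_left h2 hla
  have h4 : 0 < 1 + l a * (l b)⁻¹ := by linarith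
  have h5 := mul_pos (hpos b hb') h4
  have := (hpos b hb').ne'
  have h6 : l b * (1 + l a * (l b)⁻¹) = l a + l b := by field_simp; ring
  linarith

/-- A weakening of `InRegion` which is stable under limits. -/
def InClosedRegion (s : Finset ι) (l : ι → ℝ) : Prop :=
  0 ≤ coEsymm s l ∧ ∀ a ∈ s, ∀ b ∈ s, a ≠ b → 0 ≤ l a + l b

theorem InRegion.inClosedRegion (h : InRegion s l) : InClosedRegion s l :=
  ⟨h.1.le, fun _ ha _ hb hab => h.add_nonneg ha hb hab⟩

theorem InClosedRegion.erase_pos (h : InClosedRegion s l) (ha : a ∈ s) (hla : l a < 0) :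
    ∀ b ∈ s.erase a, 0 < l b := fun b hb => by
  have := h.2 a ha b (Finset.mem_of_mem_erase hb) (Finset.ne_of_mem_erase hb).symm
  linarith

/-- Two nonpositive values with nonnegative sum are both zero, and then every term of `coEsymm` has
a zero factor. Hence the region is relatively closed where `coEsymm` is nonzero. -/
theorem InClosedRegion.inRegion_of_ne_zero (h : InClosedRegion s l) (h0 : coEsymm s l ≠ 0) :
    InRegion s l := by
  refine ⟨h.1.lt_of_ne h0.symm, fun a ha b hb hab => ?_⟩
  by_contra! hcon
  have h1 := h.2 a ha b hb hab
  have hla : l a = 0 := by linarith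
  have hlb : l b = 0 := by linarith
  refine h0 (Finset.sum_eq_zero fun c hc => ?_)
  by_cases hca : c = a
  · exact Finset.prod_eq_zero (Finset.mem_erase.2 ⟨fun h => hab (hca ▸ h.symm), hb⟩) hlb
  · exact Finset.prod_eq_zero (Finset.mem_erase.2 ⟨fun h => hca h.symm, ha⟩) hla

theorem InClosedRegion.neg_mul_sum_le (h : InClosedRegion s l) (ha : a ∈ s) (hla : l a < 0) :
    -l a * ∑ b ∈ s.erase a, (l b)⁻¹ ≤ 1 := by
  have := (coEsymm_nonneg_iff ha (h.erase_pos ha hla)).1 h.1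
  linarith

/-- Adding `q` can only raise the negative entry and lower the reciprocals of the others. A nonzero
entry of `q` makes one of these gains strict. -/
theorem inRegion_midpoint_of_neg_of_nonneg {p q : ι → ℝ} (hp : InClosedRegion s p) (ha : a ∈ s)
    (hpa : p a < 0) (hq : ∀ b ∈ s, 0 ≤ q b) (hq0 : ∃ b ∈ s, q b ≠ 0) :
    InRegion s fun b => (1 - 1 / 2) * p b + 1 / 2 * q b := by
  have hpos := hp.erase_pos ha hpa
  have hpos' : ∀ b ∈ s.erase a, 0 < (1 - 1 / 2) * p b + 1 / 2 * q b := fun b hb => by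
    have h1 := hpos b hb
    have h2 := hq b (Finset.mem_of_mem_erase hb)
    linarith
  rcases le_or_gt 0 ((1 - 1 / 2) * p a + 1 / 2 * q a) with h0 | h0
  · exact inRegion_of_nonneg ha hpos' h0
  refine inRegion_of_pos_erase ha hpos' ?_
  have h1 := hp.neg_mul_sum_le ha hpa
  have hterm : ∀ b ∈ s.erase a, ((1 - 1 / 2) * p b + 1 / 2 * q b)⁻¹ ≤ 2 * (p b)⁻¹ := fun b hb => by
    have h2 := hq b (Finset.mem_of_mem_erase hb)
    have h3 := hpos b hb
    rw [show 2 * (p b)⁻¹ = (1 / 2 * p b)⁻¹ by rw [mul_inv]; norm_num]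
    exact inv_anti₀ (by linarith) (by linarith)
  have hqa := hq a ha
  obtain ⟨b, hb, hqb⟩ := hq0
  have hqb' := (hq b hb).lt_of_ne hqb.symm
  have hsum := Finset.sum_le_sum hterm
  rw [← Finset.mul_sum] at hsum
  have hSp := sum_inv_erase_nonneg hpos
  by_cases hba : b = a
  · subst hba
    have hSpos : 0 < ∑ c ∈ s.erase b, (p c)⁻¹ ∨ ∑ c ∈ s.erase b, (p c)⁻¹ = 0 :=
      hSp.lt_or_eq.imp_right Eq.symm
    have h4 := mul_le_mul_of_nonpos_left hsum h0.le
    rcases hSpos with hS | hS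
    · nlinarith [mul_pos hqb' hS]
    · rw [hS] at h4; linarith
  · have hb' : b ∈ s.erase a := Finset.mem_erase.2 ⟨hba, hb⟩
    have hlt : ((1 - 1 / 2) * p b + 1 / 2 * q b)⁻¹ < 2 * (p b)⁻¹ := by
      have h3 := hpos b hb'
      rw [show 2 * (p b)⁻¹ = (1 / 2 * p b)⁻¹ by rw [mul_inv]; norm_num]
      exact inv_strictAnti₀ (by linarith) (by linarith)
    have hsum' := Finset.sum_lt_sum hterm ⟨b, hb', hlt⟩
    rw [← Finset.mul_sum] at hsum'
    have h4 := mul_lt_mul_of_neg_left hsum' h0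
    nlinarith [mul_nonneg hqa hSp]

/-- The reciprocal of a third entry makes the bound strict; with two entries the sum could vanish.
-/
theorem InClosedRegion.add_pos_of_neg (h : InClosedRegion s l) (hs : 3 ≤ s.card) (ha : a ∈ s)
    (hla : l a < 0) {c : ι} (hc : c ∈ s) (hca : c ≠ a) : 0 < l a + l c := by
  have hpos := h.erase_pos ha hla
  have hc' : c ∈ s.erase a := Finset.mem_erase.2 ⟨hca, hc⟩
  have hcard : 0 < ((s.erase a).erase c).card := by
    rw [Finset.card_erase_of_mem hc', Finset.card_erase_of_mem ha]; omega
  obtain ⟨d, hd⟩ := Finset.card_pos.1 hcard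
  have h1 := h.neg_mul_sum_le ha hla
  rw [← Finset.add_sum_erase _ _ hc'] at h1
  have h2 : 0 < ∑ b ∈ (s.erase a).erase c, (l b)⁻¹ :=
    Finset.sum_pos (fun b hb => inv_pos.2 (hpos b (Finset.mem_of_mem_erase hb))) ⟨d, hd⟩
  have h3 : -l a * (l c)⁻¹ < 1 := by nlinarith
  rw [← div_eq_mul_inv, div_lt_one (hpos c hc')] at h3
  linarith

theorem exists_inRegion_segment_of_neg_of_neg {p q : ι → ℝ} (hp : InClosedRegion s p)
    (hq : InClosedRegion s q) (hs : 3 ≤ s.card) (ha : a ∈ s) (hpa : p a < 0) {c : ι}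
    (hc : c ∈ s) (hqc : q c < 0) (hac : a ≠ c) :
    ∃ t : ℝ, 0 ≤ t ∧ t ≤ 1 ∧ InRegion s fun b => (1 - t) * p b + t * q b := by
  have h1 := hp.add_pos_of_neg hs ha hpa hc hac.symm
  have h2 := hq.add_pos_of_neg hs hc hqc ha hac
  have hD1 : 0 < p c - p a := by linarith
  have hD2 : 0 < q a - q c := by linarith
  have hD := add_pos hD1 hD2
  -- The parameter at which entries `a` and `c` coincide. Their sum is positive there, so both are;
  -- the other entries are positive at both ends.
  set t := (p c - p a) / ((p c - p a) + (q a - q c)) with ht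
  have ht0 : 0 < t := div_pos hD1 hD
  have ht1 : t < 1 := (div_lt_one hD).2 (by linarith)
  have heq : (1 - t) * p a + t * q a = (1 - t) * p c + t * q c := by
    rw [ht]; field_simp; ring
  have hsum : 0 < ((1 - t) * p a + t * q a) + ((1 - t) * p c + t * q c) := by
    nlinarith [mul_pos (sub_pos.2 ht1) h1, mul_pos ht0 h2]
  refine ⟨t, ht0.le, ht1.le, inRegion_of_nonneg ha (fun b hb => ?_) (by linarith)⟩
  by_cases hbc : b = c
  · subst hbc; linarith
  · have h3 := hp.erase_pos ha hpa b hb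
    have h4 := hq.erase_pos hc hqc b (Finset.mem_erase.2 ⟨hbc, Finset.mem_of_mem_erase hb⟩)
    nlinarith [mul_pos (sub_pos.2 ht1) h3, mul_pos ht0 h4]

/-- Convexity of `x² / u`, strict unless the pairs `(x, u)` and `(y, v)` are proportional. -/
theorem sq_mul_inv_add_lt {x y u v : ℝ} (hu : 0 < u) (hv : 0 < v) (hne : x * v ≠ y * u) :
    (x + y) ^ 2 * (u + v)⁻¹ < x ^ 2 * u⁻¹ + y ^ 2 * v⁻¹ := by
  have h := add_pos hu hv
  have : x ^ 2 * u⁻¹ + y ^ 2 * v⁻¹ - (x + y) ^ 2 * (u + v)⁻¹ =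
      (x * v - y * u) ^ 2 * (u * v * (u + v))⁻¹ := by
    field_simp; ring
  have h2 : 0 < (x * v - y * u) ^ 2 * (u * v * (u + v))⁻¹ :=
    mul_pos (by have := sub_ne_zero.2 hne; positivity) (by positivity)
  linarith

theorem inRegion_midpoint_of_neg_of_neg {p q : ι → ℝ} (hp : InClosedRegion s p)
    (hq : InClosedRegion s q) (ha : a ∈ s) (hpa : p a < 0) (hqa : q a < 0)
    (hne : ∃ b ∈ s.erase a, -p a * q b ≠ -q a * p b) :
    InRegion s fun b => (1 - 1 / 2) * p b + 1 / 2 * q b := by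
  have hpp := hp.erase_pos ha hpa
  have hqp := hq.erase_pos ha hqa
  refine inRegion_of_pos_erase ha (fun b hb => by linarith [hpp b hb, hqp b hb]) ?_
  have hinv : ∑ b ∈ s.erase a, ((1 - 1 / 2) * p b + 1 / 2 * q b)⁻¹ =
      2 * ∑ b ∈ s.erase a, (p b + q b)⁻¹ := by
    rw [Finset.mul_sum]
    refine Finset.sum_congr rfl fun b _ => ?_
    rw [show (1 - 1 / 2) * p b + 1 / 2 * q b = 1 / 2 * (p b + q b) by ring, mul_inv]
    norm_num
  obtain ⟨b, hb, hbne⟩ := hne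
  -- Summed over `b`, the right side is at most `-p a - q a` by the bounds for `p` and `q`. Dividing
  -- by `-p a - q a` gives the strict bound at the midpoint.
  have hlt : ∑ b ∈ s.erase a, (-p a + -q a) ^ 2 * (p b + q b)⁻¹ <
      ∑ b ∈ s.erase a, ((-p a) ^ 2 * (p b)⁻¹ + (-q a) ^ 2 * (q b)⁻¹) := by
    refine Finset.sum_lt_sum (fun c hc => ?_) ⟨b, hb, sq_mul_inv_add_lt (hpp b hb) (hqp b hb) hbne⟩
    by_cases hcne : -p a * q c = -q a * p c
    · have h1 := hpp c hc
      have h2 := hqp c hc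
      have : (-p a) ^ 2 * (p c)⁻¹ + (-q a) ^ 2 * (q c)⁻¹ - (-p a + -q a) ^ 2 * (p c + q c)⁻¹ =
          (-p a * q c - -q a * p c) ^ 2 * (p c * q c * (p c + q c))⁻¹ := by
        field_simp; ring
      rw [hcne, sub_self, zero_pow two_ne_zero, zero_mul] at this
      linarith
    · exact (sq_mul_inv_add_lt (hpp c hc) (hqp c hc) hcne).le
  rw [Finset.sum_add_distrib, ← Finset.mul_sum, ← Finset.mul_sum, ← Finset.mul_sum] at hlt
  have h1 := mul_le_mul_of_nonneg_left (hp.neg_mul_sum_le ha hpa) (neg_pos.2 hpa).le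
  have h2 := mul_le_mul_of_nonneg_left (hq.neg_mul_sum_le ha hqa) (neg_pos.2 hqa).le
  have h3 : (-p a + -q a) * ((-p a + -q a) * ∑ b ∈ s.erase a, (p b + q b)⁻¹) <
      (-p a + -q a) * 1 := by nlinarith
  have h4 := lt_of_mul_lt_mul_left h3 (by linarith)
  rw [hinv]
  linarith

/-- The possibilities for a segment between two points of the closed region. -/
theorem InClosedRegion.exists_inRegion_segment {p q : ι → ℝ} (hp : InClosedRegion s p)
    (hq : InClosedRegion s q) (hs : 3 ≤ s.card) (hp0 : ∃ b ∈ s, p b ≠ 0)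
    (hq0 : ∃ b ∈ s, q b ≠ 0) :
    (∃ t : ℝ, 0 ≤ t ∧ t ≤ 1 ∧ InRegion s fun b => (1 - t) * p b + t * q b) ∨
    (∃ a ∈ s, ∃ b ∈ s, a ≠ b ∧ p a = 0 ∧ p b = 0 ∧ q a = 0 ∧ q b = 0) ∨
    ∃ c d : ℝ, 0 < c ∧ 0 < d ∧ ∀ b ∈ s, c * p b = d * q b := by
  by_cases hpn : ∃ a ∈ s, p a < 0
  · obtain ⟨a, ha, hpa⟩ := hpn
    by_cases hqn : ∃ c ∈ s, q c < 0
    · obtain ⟨c, hc, hqc⟩ := hqn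
      by_cases hac : a = c
      · subst hac
        by_cases hne : ∃ b ∈ s.erase a, -p a * q b ≠ -q a * p b
        · exact Or.inl ⟨1 / 2, by norm_num, by norm_num,
            inRegion_midpoint_of_neg_of_neg hp hq ha hpa hqc hne⟩
        · push Not at hne
          refine Or.inr (Or.inr ⟨-q a, -p a, by linarith, by linarith, fun b hb => ?_⟩)
          by_cases hba : b = a
          · subst hba; ring
          · exact (hne b (Finset.mem_erase.2 ⟨hba, hb⟩)).symm
      · exact Or.inl (exists_inRegion_segment_of_neg_of_neg hp hq hs ha hpa hc hqc hac)
    · push Not at hqn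
      exact Or.inl ⟨1 / 2, by norm_num, by norm_num,
        inRegion_midpoint_of_neg_of_nonneg hp ha hpa hqn hq0⟩
  push Not at hpn
  by_cases hqn : ∃ c ∈ s, q c < 0
  · obtain ⟨c, hc, hqc⟩ := hqn
    refine Or.inl ⟨1 / 2, by norm_num, by norm_num, ?_⟩
    convert inRegion_midpoint_of_neg_of_nonneg hq hc hqc hpn hp0 using 2
    ring
  push Not at hqn
  by_cases hz : ∃ a ∈ s, ∃ b ∈ s, a ≠ b ∧ p a = 0 ∧ p b = 0 ∧ q a = 0 ∧ q b = 0
  · exact Or.inr (Or.inl hz)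
  refine Or.inl ⟨1 / 2, by norm_num, by norm_num, ?_⟩
  -- With no negative entries, an entry of the midpoint vanishes only if it vanishes at both ends;
  -- two such entries are the second alternative.
  have hzero : ∀ b ∈ s, ¬ 0 < (1 - 1 / 2) * p b + 1 / 2 * q b → p b = 0 ∧ q b = 0 :=
    fun b hb h => by
      have h1 := hpn b hb
      have h2 := hqn b hb
      constructor <;> linarith
  by_cases h1 : ∃ a ∈ s, ¬ 0 < (1 - 1 / 2) * p a + 1 / 2 * q a
  · obtain ⟨a, ha, hla⟩ := h1
    refine inRegion_of_nonneg ha (fun b hb => ?_) (by linarith [hpn a ha, hqn a ha])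
    by_contra hlb
    have hb' := Finset.mem_of_mem_erase hb
    exact hz ⟨a, ha, b, hb', (Finset.ne_of_mem_erase hb).symm, (hzero a ha hla).1,
      (hzero b hb' hlb).1, (hzero a ha hla).2, (hzero b hb' hlb).2⟩
  · push Not at h1
    obtain ⟨b, hb, -⟩ := hp0
    exact inRegion_of_nonneg hb (fun c hc => h1 c (Finset.mem_of_mem_erase hc)) (h1 b hb).le

end ElementarySymmetric

end PuffedFiber

namespace PuffedFiber

open Filter Topology

/-! ### Facet normals, polarity and active facets. -/

section Polytope

variable {E : Type*} [NormedAddCommGroup E] [InnerProductSpace ℝ E]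

/-- The polar set of `S`, with the inequalities `⟪s, a⟫ ≤ 1`. -/
def polarSet (S : Set E) : Set E :=
  {a | ∀ s ∈ S, ⟪s, a⟫_ℝ ≤ 1}

theorem polarSet_eq_biInter (S : Set E) : polarSet S = ⋂ s ∈ S, {a | ⟪s, a⟫_ℝ ≤ 1} := by
  ext a; simp [polarSet]

theorem isClosed_polarSet (S : Set E) : IsClosed (polarSet S) := by
  rw [polarSet_eq_biInter]
  exact isClosed_biInter fun s _ => isClosed_le (by fun_prop) continuous_const

theorem polarSet_convexHull (S : Set E) : polarSet (convexHull ℝ S) = polarSet S := by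
  refine Set.Subset.antisymm (fun a h s hs => h s (subset_convexHull ℝ S hs)) fun a h => ?_
  have h1 : S ⊆ {x | ⟪a, x⟫_ℝ ≤ 1} := fun s hs => by
    have := h s hs
    rwa [real_inner_comm] at this
  intro x hx
  have := convexHull_min h1 (convex_halfSpace_le (innerₛₗ ℝ a).isLinear 1) hx
  rw [real_inner_comm]
  exact this

/-- Active constraints do not change along `w`, and the finitely many inactive ones have room to
spare. -/
theorem exists_perturbation_mem_polarSet {S : Set E} (hS : S.Finite) {a w : E}
    (ha : a ∈ polarSet S) (hw : ∀ s ∈ S, ⟪s, a⟫_ℝ = 1 → ⟪s, w⟫_ℝ = 0) :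
    ∃ ε : ℝ, 0 < ε ∧ a + ε • w ∈ polarSet S ∧ a - ε • w ∈ polarSet S := by
  have h : ∀ s ∈ S, ∀ᶠ ε : ℝ in 𝓝[>] 0, ⟪s, a + ε • w⟫_ℝ ≤ 1 ∧ ⟪s, a - ε • w⟫_ℝ ≤ 1 := by
    intro s hs
    refine Filter.Eventually.filter_mono nhdsWithin_le_nhds ?_
    rcases (ha s hs).eq_or_lt with h1 | h1
    · refine Eventually.of_forall fun ε => ?_
      simp [inner_add_right, inner_sub_right, inner_smul_right, hw s hs h1, h1]
    · have c1 : Continuous fun ε : ℝ => ⟪s, a + ε • w⟫_ℝ := by fun_prop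
      have c2 : Continuous fun ε : ℝ => ⟪s, a - ε • w⟫_ℝ := by fun_prop
      have e1 := c1.continuousAt (x := 0) |>.eventually_lt_const (u := 1) (by simpa using h1)
      have e2 := c2.continuousAt (x := 0) |>.eventually_lt_const (u := 1) (by simpa using h1)
      filter_upwards [e1, e2] with ε h1 h2 using ⟨h1.le, h2.le⟩
  have h2 := (hS.eventually_all (l := 𝓝[>] (0 : ℝ))).2 h
  obtain ⟨ε, hε, hpos⟩ := (h2.and self_mem_nhdsWithin).exists
  exact ⟨ε, hpos, fun s hs => (hε s hs).1, fun s hs => (hε s hs).2⟩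

theorem eq_zero_of_mem_extremePoints {Q : Set E} {z w : E} (hz : z ∈ Q.extremePoints ℝ) {ε : ℝ}
    (hε : 0 < ε) (h1 : z + ε • w ∈ Q) (h2 : z - ε • w ∈ Q) : w = 0 := by
  have h3 := hz.2 h1 h2 ⟨1 / 2, 1 / 2, by norm_num, by norm_num, by norm_num, by module⟩
  simpa [hε.ne'] using h3

variable {P : Set E}

theorem mem_polarSet_of_mem_facetNormals {a : E} (ha : a ∈ facetNormals P) : a ∈ polarSet P :=
  fun x hx => by rw [real_inner_comm]; exact ha.1 x hx

theorem vectorSpan_hyperplaneSection_le (P : Set E) (a : E) :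
    vectorSpan ℝ (hyperplaneSection P a) ≤ (ℝ ∙ a)ᗮ := by
  refine Submodule.span_le.2 ?_
  rintro _ ⟨x, hx, y, hy, rfl⟩
  rw [SetLike.mem_coe, Submodule.mem_orthogonal_singleton_iff_inner_right]
  simp [inner_sub_right, hx.2, hy.2]

theorem isBounded_polarSet (h0 : (0 : E) ∈ interior P) : Bornology.IsBounded (polarSet P) := by
  obtain ⟨r, hr, hball⟩ := Metric.mem_nhds_iff.1 (mem_interior_iff_mem_nhds.1 h0)
  refine isBounded_iff_forall_norm_le.2 ⟨2 / r, fun a ha => ?_⟩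
  by_cases ha0 : a = 0
  · subst ha0; simp; positivity
  have hn : 0 < ‖a‖ := norm_pos_iff.2 ha0
  have h1 := ha ((r / 2 * ‖a‖⁻¹) • a) (hball (by
    rw [mem_ball_zero_iff, norm_smul, Real.norm_of_nonneg (by positivity), mul_assoc,
      inv_mul_cancel₀ hn.ne']
    linarith))
  rw [real_inner_smul_left, real_inner_self_eq_norm_sq] at h1
  rw [le_div_iff₀ hr]
  have h2 : r / 2 * ‖a‖⁻¹ * ‖a‖ ^ 2 = r / 2 * ‖a‖ := by field_simp
  linarith

theorem IsPolytope.isCompact (hP : IsPolytope P) : IsCompact P := by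
  obtain ⟨S, hS, rfl⟩ := hP
  exact hS.isCompact_convexHull ℝ

variable [FiniteDimensional ℝ E]

theorem finrank_orthogonal_singleton {a : E} (ha : a ≠ 0) :
    Module.finrank ℝ (ℝ ∙ a)ᗮ + 1 = Module.finrank ℝ E := by
  rw [← Submodule.finrank_add_finrank_orthogonal (ℝ ∙ a), finrank_span_singleton ha, add_comm]

/-- The section lies in a hyperplane off the origin, so it has full dimension there iff its points
span `E` linearly. -/
theorem facet_iff_forall_eq_zero {a : E} (hne : (hyperplaneSection P a).Nonempty) :
    Module.finrank ℝ (vectorSpan ℝ (hyperplaneSection P a)) + 1 = Module.finrank ℝ E ↔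
      ∀ w : E, (∀ g ∈ hyperplaneSection P a, ⟪w, g⟫_ℝ = 0) → w = 0 := by
  obtain ⟨g₀, hg₀⟩ := hne
  have ha0 : a ≠ 0 := by
    rintro rfl
    simpa using hg₀.2
  rw [← finrank_orthogonal_singleton ha0, Nat.add_right_cancel_iff]
  constructor
  · intro h w hw
    have heq := Submodule.eq_of_le_of_finrank_eq (vectorSpan_hyperplaneSection_le P a) h
    have hw' : w ∈ (vectorSpan ℝ (hyperplaneSection P a))ᗮ := by
      rw [vectorSpan_def, Submodule.mem_orthogonal']
      intro u hu
      induction hu using Submodule.span_induction with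
      | mem u hu =>
        obtain ⟨x, hx, y, hy, rfl⟩ := hu
        simp [inner_sub_right, hw x hx, hw y hy]
      | zero => simp
      | add u v _ _ hu hv => rw [inner_add_right, hu, hv, add_zero]
      | smul c u _ hu => rw [inner_smul_right, hu, mul_zero]
    rw [heq, Submodule.orthogonal_orthogonal] at hw'
    obtain ⟨c, rfl⟩ := Submodule.mem_span_singleton.1 hw'
    have := hw g₀ hg₀
    rw [real_inner_smul_left, hg₀.2, mul_one] at this
    rw [this, zero_smul]
  · intro h
    have : vectorSpan ℝ (hyperplaneSection P a) = (ℝ ∙ a)ᗮ := by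
      refine le_antisymm (vectorSpan_hyperplaneSection_le P a) ?_
      rw [← Submodule.orthogonal_orthogonal (vectorSpan ℝ (hyperplaneSection P a))]
      refine Submodule.orthogonal_le fun w hw => ?_
      have hconst : w - ⟪w, g₀⟫_ℝ • a = 0 := h _ fun g hg => by
        have h1 := (Submodule.mem_orthogonal' _ _).1 hw _ (vsub_mem_vectorSpan ℝ hg hg₀)
        rw [vsub_eq_sub, inner_sub_right] at h1
        rw [inner_sub_left, real_inner_smul_left, hg.2]
        linarith
      exact Submodule.mem_span_singleton.2 ⟨_, (sub_eq_zero.1 hconst).symm⟩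
    rw [this]

variable {S : Set E}

theorem eq_zero_of_mem_facetNormals_of_active (hS : S.Finite) {a w : E}
    (ha : a ∈ facetNormals (convexHull ℝ S))
    (hw : ∀ s ∈ S, ⟪s, a⟫_ℝ = 1 → ⟪s, w⟫_ℝ = 0) : w = 0 := by
  refine (facet_iff_forall_eq_zero ha.2.1).1 ha.2.2 w fun g hg => ?_
  have haS := mem_polarSet_of_mem_facetNormals ha
  rw [polarSet_convexHull] at haS
  obtain ⟨ε, hε, h1, h2⟩ := exists_perturbation_mem_polarSet hS haS hw
  rw [← polarSet_convexHull] at h1 h2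
  have h3 := h1 g hg.1
  have h4 := h2 g hg.1
  have h5 := hg.2
  rw [real_inner_comm] at h5
  rw [inner_add_right, inner_smul_right, h5] at h3
  rw [inner_sub_right, inner_smul_right, h5] at h4
  rw [real_inner_comm]
  have h6 : ε * ⟪g, w⟫_ℝ = 0 := by linarith
  exact (mul_eq_zero.1 h6).resolve_left hε.ne'

/-- A facet normal is determined by the subset of the finite generating set on which it is active.
-/
theorem finite_facetNormals (hP : IsPolytope P) : (facetNormals P).Finite := by
  obtain ⟨S, hS, rfl⟩ := hP
  refine Set.Finite.of_finite_image (f := fun a => {s ∈ S | ⟪s, a⟫_ℝ = 1})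
    (hS.finite_subsets.subset ?_) ?_
  · rintro _ ⟨a, _, rfl⟩ s hs
    exact hs.1
  · intro a ha b hb hab
    refine sub_eq_zero.1 (eq_zero_of_mem_facetNormals_of_active hS ha fun s hs hsa => ?_)
    have hsb : s ∈ {s ∈ S | ⟪s, b⟫_ℝ = 1} := by
      rw [← show _ = {s ∈ S | ⟪s, b⟫_ℝ = 1} from hab]; exact ⟨hs, hsa⟩
    rw [inner_sub_right, hsa, hsb.2, sub_self]

theorem mem_facetNormals_of_mem_extremePoints (hS : S.Finite) {a : E} (ha0 : a ≠ 0)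
    (ha : a ∈ (polarSet S).extremePoints ℝ) : a ∈ facetNormals (convexHull ℝ S) := by
  have key : ∀ w : E, (∀ s ∈ S, ⟪s, a⟫_ℝ = 1 → ⟪s, w⟫_ℝ = 0) → w = 0 := fun w hw => by
    obtain ⟨ε, hε, h1, h2⟩ := exists_perturbation_mem_polarSet hS ha.1 hw
    exact eq_zero_of_mem_extremePoints ha hε h1 h2
  have hT : ∀ s ∈ S, ⟪s, a⟫_ℝ = 1 → s ∈ hyperplaneSection (convexHull ℝ S) a := fun s hs hsa =>
    ⟨subset_convexHull ℝ S hs, by rwa [real_inner_comm]⟩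
  have hne : (hyperplaneSection (convexHull ℝ S) a).Nonempty := by
    by_contra hemp
    exact ha0 (key a fun s hs hsa => (hemp ⟨s, hT s hs hsa⟩).elim)
  refine ⟨fun x hx => ?_, hne, (facet_iff_forall_eq_zero hne).2 fun w hw => key w fun s hs hsa => ?_⟩
  · have := ha.1
    rw [← polarSet_convexHull] at this
    rw [real_inner_comm]; exact this x hx
  · rw [real_inner_comm]; exact hw s (hT s hs hsa)

/-- A point outside `P` is cut off by some element of the compact polar. Maximizing that point's
pairing over the polar, an extreme point of the maximal face cuts it off as well, and nonzero
extreme points of the polar are facet normals. -/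
theorem eq_polarSet_facetNormals (hP : IsPolytope P) (h0 : (0 : E) ∈ interior P) :
    P = polarSet (facetNormals P) := by
  refine Set.Subset.antisymm (fun x hx a ha => ha.1 x hx) fun y hy => ?_
  by_contra hyP
  have hP' := hP
  obtain ⟨S, hS, rfl⟩ := hP'
  obtain ⟨f, u, hfu, huf⟩ := geometric_hahn_banach_closed_point (convex_convexHull ℝ S)
    (hS.isCompact_convexHull ℝ).isClosed hyP
  have hu : 0 < u := by simpa using hfu 0 (interior_subset h0)
  let a₀ : E := u⁻¹ • (InnerProductSpace.toDual ℝ E).symm f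
  have ha₀ : ∀ x, ⟪x, a₀⟫_ℝ = u⁻¹ * f x := fun x => by
    rw [inner_smul_right, real_inner_comm, InnerProductSpace.toDual_symm_apply]
  have hmem : a₀ ∈ polarSet S := by
    rw [← polarSet_convexHull]
    intro x hx
    rw [ha₀, inv_mul_le_iff₀ hu, mul_one]
    exact (hfu x hx).le
  have hgt : 1 < ⟪y, a₀⟫_ℝ := by
    rw [ha₀, lt_inv_mul_iff₀ hu, mul_one]; exact huf
  have hcomp : IsCompact (polarSet S) :=
    Metric.isCompact_of_isClosed_isBounded (isClosed_polarSet S)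
      (by rw [← polarSet_convexHull]; exact isBounded_polarSet h0)
  let g : StrongDual ℝ E := innerSL ℝ y
  have hexp : IsExposed ℝ (polarSet S) (g.toExposed (polarSet S)) :=
    ContinuousLinearMap.toExposed.isExposed
  obtain ⟨a₁, ha₁, hmax⟩ := hcomp.exists_isMaxOn ⟨a₀, hmem⟩ g.continuous.continuousOn
  obtain ⟨a, ha⟩ := (hexp.isCompact hcomp).extremePoints_nonempty ⟨a₁, ha₁, hmax⟩
  have hge : ⟪y, a₀⟫_ℝ ≤ ⟪y, a⟫_ℝ := ha.1.2 a₀ hmem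
  have ha' := hexp.isExtreme.extremePoints_subset_extremePoints ha
  have hane : a ≠ 0 := by
    rintro rfl
    rw [inner_zero_right] at hge
    linarith
  have h1 := hy a (mem_facetNormals_of_mem_extremePoints hS hane ha')
  rw [real_inner_comm] at h1
  linarith

/-- Such a `v` is a recession direction of the bounded set `P`. -/
theorem eq_zero_of_inner_facetNormals_nonpos (hP : IsPolytope P) (h0 : (0 : E) ∈ interior P)
    {v : E} (hv : ∀ a ∈ facetNormals P, ⟪a, v⟫_ℝ ≤ 0) : v = 0 := by
  by_contra hv0
  obtain ⟨R, hR⟩ := hP.isCompact.isBounded.exists_norm_le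
  have hR0 : 0 ≤ R := by simpa using hR 0 (interior_subset h0)
  have hn : 0 < ‖v‖ := norm_pos_iff.2 hv0
  have hmem : ((R + 1) * ‖v‖⁻¹) • v ∈ P := by
    rw [eq_polarSet_facetNormals hP h0]
    intro a ha
    rw [inner_smul_right]
    have : 0 ≤ (R + 1) * ‖v‖⁻¹ := by positivity
    nlinarith [mul_nonneg this (neg_nonneg.2 (hv a ha))]
  have h1 := hR _ hmem
  rw [norm_smul, Real.norm_of_nonneg (by positivity), mul_assoc, inv_mul_cancel₀ hn.ne'] at h1
  linarith

theorem exists_ne_zero_mem_orthogonal {U : Submodule ℝ E}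
    (hU : Module.finrank ℝ U < Module.finrank ℝ E) : ∃ w ∈ Uᗮ, w ≠ 0 := by
  have h := Submodule.finrank_add_finrank_orthogonal U
  have : Uᗮ ≠ ⊥ := by
    intro hbot
    rw [hbot, finrank_bot] at h
    omega
  exact (Submodule.ne_bot_iff _).1 this

theorem finrank_le_card_facetNormals (hP : IsPolytope P) (h0 : (0 : E) ∈ interior P) :
    Module.finrank ℝ E ≤ (finite_facetNormals hP).toFinset.card := by
  by_contra! hlt
  obtain ⟨w, hw, hw0⟩ := exists_ne_zero_mem_orthogonal
    ((finrank_span_finset_le_card (R := ℝ) (finite_facetNormals hP).toFinset).trans_lt hlt)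
  refine hw0 (eq_zero_of_inner_facetNormals_nonpos hP h0 fun a ha => le_of_eq ?_)
  exact (Submodule.mem_orthogonal _ _).1 hw a (Submodule.subset_span (by simpa using ha))

/-- Take an extreme point of the slice. With at most one active normal `a`, the space `V + span {e,
a}` is proper, and moving along a vector orthogonal to it stays in the slice. -/
theorem exists_two_active_facets (hP : IsPolytope P) (h0 : (0 : E) ∈ interior P)
    {V : Submodule ℝ E} (hV : Module.finrank ℝ V + 3 ≤ Module.finrank ℝ E) (x : V) (e : E) (t : ℝ)
    (hne : ∃ z ∈ P, V.orthogonalProjectionOnto z = x ∧ ⟪e, z⟫_ℝ = t) :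
    ∃ z ∈ P, V.orthogonalProjectionOnto z = x ∧ ⟪e, z⟫_ℝ = t ∧
      ∃ a ∈ facetNormals P, ∃ b ∈ facetNormals P, a ≠ b ∧ ⟪a, z⟫_ℝ = 1 ∧ ⟪b, z⟫_ℝ = 1 := by
  have hQ : IsCompact {z ∈ P | V.orthogonalProjectionOnto z = x ∧ ⟪e, z⟫_ℝ = t} :=
    hP.isCompact.inter_right ((isClosed_eq (by fun_prop) continuous_const).inter
      (isClosed_eq (by fun_prop) continuous_const))
  obtain ⟨z, hz⟩ := hQ.extremePoints_nonempty hne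
  refine ⟨z, hz.1.1, hz.1.2.1, hz.1.2.2, ?_⟩
  by_contra! hcon
  have hactive : ∃ a : E, ∀ b ∈ facetNormals P, ⟪b, z⟫_ℝ = 1 → b = a := by
    by_cases h : ∃ a ∈ facetNormals P, ⟪a, z⟫_ℝ = 1
    · obtain ⟨a, ha, haz⟩ := h
      exact ⟨a, fun b hb hbz => by_contra fun hba => hcon a ha b hb (Ne.symm hba) haz hbz⟩
    -- With no active facet, `0` is a dummy normal.
    · exact ⟨0, fun b hb hbz => (h ⟨b, hb, hbz⟩).elim⟩
  obtain ⟨a, ha⟩ := hactive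
  classical
  have hfin : Module.finrank ℝ (V ⊔ Submodule.span ℝ (({e, a} : Finset E) : Set E) : Submodule ℝ E)
      < Module.finrank ℝ E := by
    have h1 := Submodule.finrank_add_le_finrank_add_finrank V
      (Submodule.span ℝ (({e, a} : Finset E) : Set E))
    have h2 : Module.finrank ℝ (Submodule.span ℝ (({e, a} : Finset E) : Set E)) ≤ _ :=
      finrank_span_finset_le_card (R := ℝ) ({e, a} : Finset E)
    have h3 : ({e, a} : Finset E).card ≤ 2 := Finset.card_le_two
    omega
  obtain ⟨w, hw, hw0⟩ := exists_ne_zero_mem_orthogonal hfin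
  rw [Submodule.mem_orthogonal] at hw
  have hspan : ∀ v ∈ ({e, a} : Finset E), ⟪v, w⟫_ℝ = 0 := fun v hv =>
    hw v (Submodule.mem_sup_right (Submodule.subset_span hv))
  have hew := hspan e (by simp)
  have haw := hspan a (by simp)
  have hwV : V.orthogonalProjectionOnto w = 0 :=
    Submodule.orthogonalProjectionOnto_apply_of_mem_orthogonal
      ((Submodule.mem_orthogonal _ _).2 fun v hv => hw v (Submodule.mem_sup_left hv))
  have hzP := hz.1.1
  rw [eq_polarSet_facetNormals hP h0] at hzP
  obtain ⟨ε, hε, h1, h2⟩ := exists_perturbation_mem_polarSet (finite_facetNormals hP) hzP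
    (w := w) fun b hb hbz => by rw [ha b hb hbz, haw]
  rw [← eq_polarSet_facetNormals hP h0] at h1 h2
  refine hw0 (eq_zero_of_mem_extremePoints hz hε ⟨h1, ?_, ?_⟩ ⟨h2, ?_, ?_⟩)
  · rw [map_add, map_smul, hwV, smul_zero, add_zero, hz.1.2.1]
  · rw [inner_add_right, inner_smul_right, hew, mul_zero, add_zero, hz.1.2.2]
  · rw [map_sub, map_smul, hwV, smul_zero, sub_zero, hz.1.2.1]
  · rw [inner_sub_right, inner_smul_right, hew, mul_zero, sub_zero, hz.1.2.2]

end Polytope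

end PuffedFiber

namespace PuffedFiber

open Filter Topology

/-! ### The first puffed polytope in terms of slacks. -/

section Puffed

variable {E : Type*} [NormedAddCommGroup E] [InnerProductSpace ℝ E]

/-- The slack of the inequality `⟪a, x⟫ ≤ 1`. -/
def slack (x a : E) : ℝ := 1 - ⟪a, x⟫_ℝ

theorem continuous_slack (a : E) : Continuous fun x : E => slack x a := by
  unfold slack; fun_prop

theorem slack_combination (x y a : E) (t : ℝ) :
    slack ((1 - t) • x + t • y) a = (1 - t) * slack x a + t * slack y a := by
  simp only [slack, inner_add_right, inner_smul_right]; ring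

theorem exists_slack_ne_zero [FiniteDimensional ℝ E] [Nontrivial E] {P : Set E}
    (hP : IsPolytope P) (h0 : (0 : E) ∈ interior P) (x : E) :
    ∃ a ∈ (finite_facetNormals hP).toFinset, slack x a ≠ 0 := by
  by_contra! h
  have hx : ∀ a ∈ facetNormals P, ⟪a, x⟫_ℝ = 1 := fun a ha => by
    have := h a (by simpa using ha)
    rw [slack] at this; linarith
  have hx0 : -x = 0 := eq_zero_of_inner_facetNormals_nonpos hP h0 fun a ha => by
    rw [inner_neg_right, hx a ha]; norm_num
  obtain ⟨a, ha⟩ := Finset.card_pos.1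
    (Module.finrank_pos.trans_le (finrank_le_card_facetNormals hP h0))
  have h1 := hx a (by simpa using ha)
  rw [neg_eq_zero.1 hx0, inner_zero_right] at h1
  norm_num at h1

variable [DecidableEq E]

theorem continuous_coEsymm_slack (s : Finset E) : Continuous fun x : E => coEsymm s (slack x) :=
  continuous_finsetSum _ fun _ _ => continuous_finsetProd _ fun b _ => continuous_slack b

theorem isOpen_inRegion (s : Finset E) : IsOpen {x : E | InRegion s (slack x)} := by
  have : {x : E | InRegion s (slack x)} = {x | 0 < coEsymm s (slack x)} ∩
      ⋂ a ∈ s, ⋂ b ∈ s, {x | a ≠ b → 0 < slack x a ∨ 0 < slack x b} := by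
    ext x; simp [InRegion]
  rw [this]
  refine (isOpen_lt continuous_const (continuous_coEsymm_slack s)).inter
    (isOpen_biInter_finset fun a _ => isOpen_biInter_finset fun b _ => ?_)
  by_cases hab : a = b
  · simp [hab]
  · simp only [ne_eq, hab, not_false_eq_true, true_imp_iff]
    exact (isOpen_lt continuous_const (continuous_slack a)).union
      (isOpen_lt continuous_const (continuous_slack b))

theorem isClosed_inClosedRegion (s : Finset E) : IsClosed {x : E | InClosedRegion s (slack x)} := by
  have : {x : E | InClosedRegion s (slack x)} = {x | 0 ≤ coEsymm s (slack x)} ∩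
      ⋂ a ∈ s, ⋂ b ∈ s, {x | a ≠ b → 0 ≤ slack x a + slack x b} := by
    ext x; simp [InClosedRegion]
  rw [this]
  refine (isClosed_le continuous_const (continuous_coEsymm_slack s)).inter
    (isClosed_biInter fun a _ => isClosed_biInter fun b _ => ?_)
  by_cases hab : a = b
  · simp [hab]
  · simp only [ne_eq, hab, not_false_eq_true, true_imp_iff]
    exact isClosed_le continuous_const ((continuous_slack a).add (continuous_slack b))

/-- The open region and the complement of its closed weakening are disjoint open sets covering the
nonvanishing locus. The region itself is star-shaped about the origin. -/
theorem connectedComponentIn_coEsymm_ne_zero {s : Finset E} (hs : s.Nonempty) :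
    connectedComponentIn {x : E | coEsymm s (slack x) ≠ 0} 0 = {x | InRegion s (slack x)} := by
  have h0 : (0 : E) ∈ {x : E | InRegion s (slack x)} := by
    obtain ⟨a, ha⟩ := hs
    exact inRegion_of_nonneg ha (by simp [slack]) (by simp [slack])
  have hsub : {x : E | InRegion s (slack x)} ⊆ {x : E | coEsymm s (slack x) ≠ 0} :=
    fun x hx => hx.1.ne'
  have hstar : StarConvex ℝ (0 : E) {x : E | InRegion s (slack x)} := by
    intro x hx c t hc ht hct
    have hx' : InRegion s (slack x) := hx
    have h1 := hx'.segment hs ht (by linarith)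
    have h2 : slack (c • (0 : E) + t • x) = fun b => (1 - t) + t * slack x b := by
      funext b
      simp only [slack, smul_zero, zero_add, inner_smul_right]; ring
    change InRegion s (slack (c • (0 : E) + t • x))
    rwa [h2]
  refine Set.Subset.antisymm ?_ ?_
  · refine IsPreconnected.subset_left_of_subset_union (isOpen_inRegion s)
      (isClosed_inClosedRegion s).isOpen_compl ?_ ?_
      ⟨0, mem_connectedComponentIn (hsub h0), h0⟩ isPreconnected_connectedComponentIn
    · exact Set.disjoint_compl_right_iff_subset.2 fun x hx => InRegion.inClosedRegion hx
    · intro x hx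
      by_cases hc : InClosedRegion s (slack x)
      · exact Or.inl (hc.inRegion_of_ne_zero (connectedComponentIn_subset _ _ hx))
      · exact Or.inr hc
  · exact (StarConvex.isPathConnected hstar h0).isConnected.isPreconnected.subset_connectedComponentIn h0 hsub

theorem derivZeroLocus_one {P : Set E} (hfin : (facetNormals P).Finite) :
    (derivZeroLocus 1 P)ᶜ = {x : E | coEsymm hfin.toFinset (slack x) ≠ 0} := by
  ext x
  have hpoly : homogenizedPoly P x =
      ∏ a ∈ hfin.toFinset, (Polynomial.C ⟪a, x⟫_ℝ - Polynomial.X) := by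
    rw [homogenizedPoly, finprod_mem_eq_finite_toFinset_prod _ hfin]
  have heval : (Polynomial.derivative (homogenizedPoly P x)).eval 1 =
      -((-1) ^ (hfin.toFinset.card - 1) * coEsymm hfin.toFinset (slack x)) := by
    rw [hpoly, Polynomial.derivative_prod_finset, Polynomial.eval_finsetSum, coEsymm, Finset.mul_sum,
      ← Finset.sum_neg_distrib]
    refine Finset.sum_congr rfl fun a ha => ?_
    rw [← Finset.card_erase_of_mem ha, ← Finset.prod_const, ← Finset.prod_mul_distrib]
    simp [Polynomial.eval_prod, slack]
  simp [derivZeroLocus, heval]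

variable [FiniteDimensional ℝ E] {P : Set E}

theorem puffed_one_eq [Nontrivial E] (hP : IsPolytope P) (h0 : (0 : E) ∈ interior P) :
    puffed 1 P = closure {x | InRegion (finite_facetNormals hP).toFinset (slack x)} := by
  rw [puffed, derivZeroLocus_one (finite_facetNormals hP), connectedComponentIn_coEsymm_ne_zero]
  exact Finset.card_pos.1 (Module.finrank_pos.trans_le (finrank_le_card_facetNormals hP h0))

theorem inClosedRegion_of_mem_puffed [Nontrivial E] (hP : IsPolytope P)
    (h0 : (0 : E) ∈ interior P) {x : E} (hx : x ∈ puffed 1 P) :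
    InClosedRegion (finite_facetNormals hP).toFinset (slack x) := by
  rw [puffed_one_eq hP h0] at hx
  exact closure_minimal (fun x hx => InRegion.inClosedRegion hx) (isClosed_inClosedRegion _) hx

/-- For `x ∈ P` and `0 < t < 1`, all slacks at `t • x` are positive. -/
theorem subset_puffed_one [Nontrivial E] (hP : IsPolytope P) (h0 : (0 : E) ∈ interior P) :
    P ⊆ puffed 1 P := by
  rw [puffed_one_eq hP h0]
  intro x hx
  have hlim : Tendsto (fun t : ℝ => t • x) (𝓝[<] 1) (𝓝 x) := by
    have : ContinuousAt (fun t : ℝ => t • x) 1 := by fun_prop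
    simpa using this.tendsto.mono_left nhdsWithin_le_nhds
  refine mem_closure_of_tendsto hlim ?_
  have h01 : ∀ᶠ t : ℝ in 𝓝[<] 1, 0 < t := nhdsWithin_le_nhds (lt_mem_nhds one_pos)
  filter_upwards [h01, self_mem_nhdsWithin] with t ht0 ht1
  have ht1 : t < 1 := ht1
  have hpos : ∀ a ∈ facetNormals P, 0 < slack (t • x) a := fun a ha => by
    have h1 := ha.1 x hx
    rw [slack, inner_smul_right]
    nlinarith
  obtain ⟨a, ha⟩ := Finset.card_pos.1
    (Module.finrank_pos.trans_le (finrank_le_card_facetNormals hP h0))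
  exact inRegion_of_nonneg ha
    (fun b hb => hpos b (by simpa using Finset.mem_of_mem_erase hb)) (hpos a (by simpa using ha)).le

/-- A segment with ends in the first puffed polytope meets its interior, or lies in a codimension
two face of the polytope. -/
theorem exists_inRegion_segment_or_active (hP : IsPolytope P) (h0 : (0 : E) ∈ interior P)
    (hdim : 3 ≤ Module.finrank ℝ E) {x y : E} (hx : x ∈ puffed 1 P) (hy : y ∈ puffed 1 P)
    (hxy : x ≠ y) :
    (∃ t : ℝ, 0 ≤ t ∧ t ≤ 1 ∧
      InRegion (finite_facetNormals hP).toFinset (slack ((1 - t) • x + t • y))) ∨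
    ∃ a ∈ facetNormals P, ∃ b ∈ facetNormals P, a ≠ b ∧
      ⟪a, x⟫_ℝ = 1 ∧ ⟪b, x⟫_ℝ = 1 ∧ ⟪a, y⟫_ℝ = 1 ∧ ⟪b, y⟫_ℝ = 1 := by
  have : Nontrivial E := Module.nontrivial_of_finrank_pos (R := ℝ) (by omega)
  have hcard := hdim.trans (finrank_le_card_facetNormals hP h0)
  rcases (inClosedRegion_of_mem_puffed hP h0 hx).exists_inRegion_segment
    (inClosedRegion_of_mem_puffed hP h0 hy) hcard (exists_slack_ne_zero hP h0 x)
    (exists_slack_ne_zero hP h0 y) with ⟨t, ht0, ht1, h⟩ | ⟨a, ha, b, hb, hab, h1, h2, h3, h4⟩ |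
    ⟨c, d, hc, hd, h⟩
  · refine Or.inl ⟨t, ht0, ht1, ?_⟩
    rwa [show slack ((1 - t) • x + t • y) = _ from funext fun a => slack_combination x y a t]
  · simp only [slack, sub_eq_zero] at h1 h2 h3 h4
    exact Or.inr ⟨a, by simpa using ha, b, by simpa using hb, hab, h1.symm, h2.symm, h3.symm,
      h4.symm⟩
  -- Proportional slacks give `c • x - d • y` the same pairing `c - d` with every facet normal. It
  -- or its negative is then a recession direction, hence zero, so `c = d` and `x = y`.
  · exfalso
    have hin : ∀ a ∈ facetNormals P, ⟪a, c • x - d • y⟫_ℝ = c - d := fun a ha => by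
      have := h a (by simpa using ha)
      simp only [slack] at this
      rw [inner_sub_right, inner_smul_right, inner_smul_right]
      linarith
    have hzero : c • x - d • y = 0 := by
      rcases le_total c d with hcd | hcd
      · exact eq_zero_of_inner_facetNormals_nonpos hP h0 fun a ha => by rw [hin a ha]; linarith
      · rw [← neg_eq_zero]
        exact eq_zero_of_inner_facetNormals_nonpos hP h0 fun a ha => by
          rw [inner_neg_right, hin a ha]; linarith
    obtain ⟨a, ha⟩ := Finset.card_pos.1 (lt_of_lt_of_le (by norm_num) hcard)
    have h1 := hin a (by simpa using ha)
    rw [hzero, inner_zero_right] at h1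
    have hcd : c = d := by linarith
    subst hcd
    rw [← smul_sub, smul_eq_zero] at hzero
    exact hxy (sub_eq_zero.1 (hzero.resolve_left hc.ne'))

end Puffed

end PuffedFiber

namespace PuffedFiber

open MeasureTheory Filter Topology

/-! ### Exceptional fibers and the dichotomy in `m`. -/

section Main

variable {E : Type*} [NormedAddCommGroup E] [InnerProductSpace ℝ E] [FiniteDimensional ℝ E]
  {P : Set E} {V : Submodule ℝ E}

theorem isCompact_puffed {i : ℕ} (h : Bornology.IsBounded (puffed i P)) :
    IsCompact (puffed i P) :=
  Metric.isCompact_of_isClosed_isBounded isClosed_closure h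

/-- The region is open, so a small move along `u` would increase the maximum. -/
theorem not_inRegion_of_mem_face [DecidableEq E] [Nontrivial E] (hP : IsPolytope P)
    (h0 : (0 : E) ∈ interior P) {x : V} {u y : Vᗮ} (hu : u ≠ 0)
    (hy : y ∈ faceInDirection (fiber V (puffed 1 P) x) u) :
    ¬ InRegion (finite_facetNormals hP).toFinset (slack ((x : E) + y)) := by
  intro hR
  have hcont : Continuous fun ε : ℝ => (x : E) + (y + ε • u : Vᗮ) := by fun_prop
  have hev : ∀ᶠ ε : ℝ in 𝓝[>] 0,
      InRegion (finite_facetNormals hP).toFinset (slack ((x : E) + (y + ε • u : Vᗮ))) := by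
    refine nhdsWithin_le_nhds (hcont.continuousAt.eventually_mem
      ((isOpen_inRegion _).mem_nhds (x := (x : E) + (y + (0 : ℝ) • u : Vᗮ)) ?_))
    simpa using hR
  obtain ⟨ε, hε, hpos⟩ := (hev.and self_mem_nhdsWithin).exists
  have hpos : 0 < ε := hpos
  have hmem : y + ε • u ∈ fiber V (puffed 1 P) x := by
    change (x : E) + (y + ε • u : Vᗮ) ∈ puffed 1 P
    rw [puffed_one_eq hP h0]
    exact subset_closure hε
  have h1 := hy.2 _ hmem
  rw [inner_add_right, inner_smul_right] at h1
  have h2 : 0 < ⟪u, u⟫_ℝ := real_inner_self_pos.2 hu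
  nlinarith

theorem exists_common_active_of_face (hP : IsPolytope P) (h0 : (0 : E) ∈ interior P)
    (hdim : 3 ≤ Module.finrank ℝ E) {x : V} {u y z : Vᗮ} (hu : u ≠ 0)
    (hy : y ∈ faceInDirection (fiber V (puffed 1 P) x) u)
    (hz : z ∈ faceInDirection (fiber V (puffed 1 P) x) u) (hyz : y ≠ z) :
    ∃ a ∈ facetNormals P, ∃ b ∈ facetNormals P, a ≠ b ∧
      ⟪a, (x : E) + y⟫_ℝ = 1 ∧ ⟪b, (x : E) + y⟫_ℝ = 1 ∧
      ⟪a, (x : E) + z⟫_ℝ = 1 ∧ ⟪b, (x : E) + z⟫_ℝ = 1 := by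
  classical
  have : Nontrivial E := Module.nontrivial_of_finrank_pos (R := ℝ) (by omega)
  refine (exists_inRegion_segment_or_active hP h0 hdim hy.1 hz.1 fun h =>
    hyz (Subtype.ext (add_left_cancel h))).resolve_left ?_
  rintro ⟨t, -, -, hR⟩
  have heq : (1 - t) • ((x : E) + y) + t • ((x : E) + z) =
      (x : E) + ((1 - t) • y + t • z : Vᗮ) := by
    push_cast; module
  rw [heq] at hR
  have hval : ⟪u, (1 - t) • y + t • z⟫_ℝ = ⟪u, y⟫_ℝ := by
    rw [inner_add_right, inner_smul_right, inner_smul_right,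
      le_antisymm (hy.2 z hz.1) (hz.2 y hy.1)]
    ring
  refine not_inRegion_of_mem_face hP h0 hu ⟨?_, fun w hw => ?_⟩ hR
  · change _ ∈ puffed 1 P
    rw [puffed_one_eq hP h0]
    exact subset_closure hR
  · rw [hval]; exact hy.2 w hw

theorem inner_proj_of_mem (c : V) (z : E) :
    ⟪c, V.orthogonalProjectionOnto z⟫_ℝ = ⟪(c : E), z⟫_ℝ :=
  Submodule.inner_orthogonalProjectionOnto_eq_of_mem_left c z

/-- The points over which the face `⟪a, x⟫ = ⟪b, x⟫ = 1` of `P` has more than one point. -/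
def wideFiberBase (V : Submodule ℝ E) (P : Set E) (a b : E) : Set V :=
  {x | ∃ y ∈ P, ∃ z ∈ P, y ≠ z ∧ V.orthogonalProjectionOnto y = x ∧
    V.orthogonalProjectionOnto z = x ∧ ⟪a, y⟫_ℝ = 1 ∧ ⟪b, y⟫_ℝ = 1 ∧ ⟪a, z⟫_ℝ = 1 ∧ ⟪b, z⟫_ℝ = 1}

/-- Slice the fiber over `x` by the levels `t` of a unit vector `e` orthogonal to `V`. Each small `t
> 0` yields a point on two facets; infinitely many levels and finitely many pairs force two levels
to share a pair. -/
theorem exists_ball_subset_iUnion_wideFiberBase (hP : IsPolytope P) (h0 : (0 : E) ∈ interior P)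
    (hV : Module.finrank ℝ V + 3 ≤ Module.finrank ℝ E) :
    ∃ r : ℝ, 0 < r ∧ ∀ x ∈ Metric.ball (0 : V) r, ∃ a ∈ facetNormals P, ∃ b ∈ facetNormals P,
      a ≠ b ∧ x ∈ wideFiberBase V P a b := by
  obtain ⟨r, hr, hball⟩ := Metric.mem_nhds_iff.1 (mem_interior_iff_mem_nhds.1 h0)
  obtain ⟨e', he', he'0⟩ := exists_ne_zero_mem_orthogonal (U := V) (by omega)
  let e : E := ‖e'‖⁻¹ • e'
  have heV : e ∈ Vᗮ := Submodule.smul_mem _ _ he'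
  have hen : ‖e‖ = 1 := norm_smul_inv_norm he'0
  refine ⟨r / 2, by positivity, fun x hx => ?_⟩
  have hx : ‖(x : E)‖ < r / 2 := by simpa using hx
  have hex : ∀ t ∈ Set.Ioo 0 (r / 2), ∃ z ∈ P, V.orthogonalProjectionOnto z = x ∧ ⟪e, z⟫_ℝ = t ∧
      ∃ a ∈ facetNormals P, ∃ b ∈ facetNormals P, a ≠ b ∧ ⟪a, z⟫_ℝ = 1 ∧ ⟪b, z⟫_ℝ = 1 := by
    intro t ht
    refine exists_two_active_facets hP h0 hV x e t ⟨(x : E) + t • e, hball ?_, ?_, ?_⟩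
    · rw [mem_ball_zero_iff]
      have h1 := norm_add_le (x : E) (t • e)
      rw [norm_smul, hen, mul_one, Real.norm_of_nonneg ht.1.le] at h1
      linarith [ht.2]
    · exact proj_add_eq x (⟨t • e, Submodule.smul_mem _ _ heV⟩ : Vᗮ)
    · rw [inner_add_right, inner_smul_right, real_inner_self_eq_norm_sq, hen,
        Submodule.inner_left_of_mem_orthogonal x.2 heV]
      ring
  choose! z hzP hzx hze a ha b hb hab haz hbz using hex
  obtain ⟨t, ht, t', ht', htt, heq⟩ := (Set.Ioo_infinite (a := (0 : ℝ)) (b := r / 2)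
    (by positivity)).exists_ne_map_eq_of_mapsTo (f := fun t => (a t, b t))
    (t := facetNormals P ×ˢ facetNormals P) (fun t ht => ⟨ha t ht, hb t ht⟩)
    ((finite_facetNormals hP).prod (finite_facetNormals hP))
  obtain ⟨h1, h2⟩ := Prod.ext_iff.1 heq
  simp only at h1 h2
  refine ⟨a t, ha t ht, b t, hb t ht, hab t ht, z t, hzP t ht, z t', hzP t' ht', fun hzz => htt ?_,
    hzx t ht, hzx t' ht', haz t ht, hbz t ht, h1 ▸ haz t' ht', h2 ▸ hbz t' ht'⟩
  rw [← hze t ht, ← hze t' ht', hzz]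

variable [MeasurableSpace E] [BorelSpace E]

theorem lebesgueOn_hyperplane {c : V} (hc : c ≠ 0) (r : ℝ) :
    lebesgueOn V {x : V | ⟪c, x⟫_ℝ = r} = 0 := by
  by_cases hne : ∃ p : V, ⟪c, p⟫_ℝ = r
  · obtain ⟨p, hp⟩ := hne
    have hset : {x : V | ⟪c, x⟫_ℝ = r} = (AffineSubspace.mk' p (ℝ ∙ c)ᗮ : Set V) := by
      ext x
      rw [SetLike.mem_coe, AffineSubspace.mem_mk', vsub_eq_sub,
        Submodule.mem_orthogonal_singleton_iff_inner_right, inner_sub_right, hp, sub_eq_zero]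
      rfl
    rw [hset]
    refine Measure.addHaar_affineSubspace _ _ fun htop => ?_
    have h1 : p + c ∈ AffineSubspace.mk' p (ℝ ∙ c)ᗮ := htop ▸ AffineSubspace.mem_top ℝ V _
    rw [AffineSubspace.mem_mk', vsub_eq_sub, add_sub_cancel_left,
      Submodule.mem_orthogonal_singleton_iff_inner_right, inner_self_eq_zero] at h1
    exact hc h1
  · convert measure_empty (μ := lebesgueOn V)
    exact Set.eq_empty_iff_forall_notMem.2 fun x hx => hne ⟨x, hx⟩

/-- The difference `w` of two points in one fiber is orthogonal to `V`, `a` and `b`. As `V` has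
codimension two, `V` meets `span {a, b}` in some `c = s • a + t • b ≠ 0`, and `⟪c, x⟫ = s + t` on
the whole set. -/
theorem lebesgueOn_nontrivial_fiber_codim_two (hV : Module.finrank ℝ V + 2 = Module.finrank ℝ E)
    {a b : E} (hab : a ≠ b) :
    lebesgueOn V {x : V | ∃ y z : Vᗮ, y ≠ z ∧ ⟪a, (x : E) + y⟫_ℝ = 1 ∧ ⟪b, (x : E) + y⟫_ℝ = 1 ∧
      ⟪a, (x : E) + z⟫_ℝ = 1 ∧ ⟪b, (x : E) + z⟫_ℝ = 1} = 0 := by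
  rcases Set.eq_empty_or_nonempty {x : V | ∃ y z : Vᗮ, y ≠ z ∧ ⟪a, (x : E) + y⟫_ℝ = 1 ∧
      ⟪b, (x : E) + y⟫_ℝ = 1 ∧ ⟪a, (x : E) + z⟫_ℝ = 1 ∧ ⟪b, (x : E) + z⟫_ℝ = 1} with hemp |
      ⟨x₀, y₀, z₀, hne, hay, hby, haz, hbz⟩
  · rw [hemp, measure_empty]
  have hli : LinearIndependent ℝ ![a, b] := by
    rw [LinearIndependent.pair_iff]
    intro s t hst
    have h1 : ⟪s • a + t • b, (x₀ : E) + y₀⟫_ℝ = 0 := by rw [hst, inner_zero_left]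
    rw [inner_add_left, real_inner_smul_left, real_inner_smul_left, hay, hby] at h1
    have hts : t = -s := by linarith
    subst hts
    have h2 : s • (a - b) = 0 := by rw [← hst]; module
    have h3 := (smul_eq_zero.1 h2).resolve_right (sub_ne_zero.2 hab)
    simp [h3]
  have hspan : Module.finrank ℝ (Submodule.span ℝ {a, b}) = 2 := by
    have := finrank_span_eq_card hli
    rwa [Matrix.range_cons_cons_empty, Fintype.card_fin] at this
  set w : E := ((y₀ - z₀ : Vᗮ) : E) with hw
  have hw0 : w ≠ 0 := fun h => hne (sub_eq_zero.1 (Subtype.ext h))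
  have hle : V ⊔ Submodule.span ℝ {a, b} ≤ (ℝ ∙ w)ᗮ := by
    refine sup_le (fun v hv => ?_) (Submodule.span_le.2 ?_)
    · rw [Submodule.mem_orthogonal_singleton_iff_inner_left]
      exact Submodule.inner_right_of_mem_orthogonal hv (y₀ - z₀).2
    · have hwe : w = ((x₀ : E) + y₀) - ((x₀ : E) + z₀) := by rw [hw]; push_cast; abel
      rintro v (rfl | rfl)
      · rw [SetLike.mem_coe, Submodule.mem_orthogonal_singleton_iff_inner_left, hwe,
          inner_sub_right, hay, haz, sub_self]
      · rw [SetLike.mem_coe, Submodule.mem_orthogonal_singleton_iff_inner_left, hwe,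
          inner_sub_right, hby, hbz, sub_self]
  have hinf : V ⊓ Submodule.span ℝ {a, b} ≠ ⊥ := by
    intro hbot
    have h1 := Submodule.finrank_sup_add_finrank_inf_eq V (Submodule.span ℝ {a, b})
    rw [hbot, finrank_bot, hspan] at h1
    have h2 := Submodule.finrank_mono hle
    have h3 := finrank_orthogonal_singleton hw0
    omega
  obtain ⟨c, ⟨hcV, hcs⟩, hc0⟩ := (Submodule.ne_bot_iff _).1 hinf
  obtain ⟨s, t, hst⟩ := Submodule.mem_span_pair.1 hcs
  have hc0' : (⟨c, hcV⟩ : V) ≠ 0 := fun h => hc0 (congrArg Subtype.val h)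
  refine measure_mono_null ?_ (lebesgueOn_hyperplane hc0' (s + t))
  rintro x ⟨y, z, -, hay, hby, -, -⟩
  change ⟪(⟨c, hcV⟩ : V), x⟫_ℝ = s + t
  rw [← proj_add_eq x y, inner_proj_of_mem]
  change ⟪c, _⟫_ℝ = _
  rw [← hst, inner_add_left, real_inner_smul_left, real_inner_smul_left, hay, hby]
  ring

theorem isStrictlyConvexBody_fiberBody_of_codim_two (hP : IsPolytope P)
    (h0 : (0 : E) ∈ interior P) (hbdd : Bornology.IsBounded (puffed 1 P))
    (hdim : 3 ≤ Module.finrank ℝ E) (hV : Module.finrank ℝ V + 2 = Module.finrank ℝ E) :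
    IsStrictlyConvexBody (fiberBody V (puffed 1 P)) := by
  refine isStrictlyConvexBody_of_ae_subsingleton_face (isCompact_puffed hbdd) fun u hu => ?_
  refine ae_restrict_of_ae ?_
  have hfin := finite_facetNormals hP
  have hnull : ∀ᵐ x : V ∂lebesgueOn V, ∀ a ∈ facetNormals P, ∀ b ∈ facetNormals P, a ≠ b →
      ¬ ∃ y z : Vᗮ, y ≠ z ∧ ⟪a, (x : E) + y⟫_ℝ = 1 ∧ ⟪b, (x : E) + y⟫_ℝ = 1 ∧
        ⟪a, (x : E) + z⟫_ℝ = 1 ∧ ⟪b, (x : E) + z⟫_ℝ = 1 := by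
    refine (ae_ball_iff hfin.countable).2 fun a _ => (ae_ball_iff hfin.countable).2 fun b _ => ?_
    by_cases hab : a = b
    · exact ae_of_all _ fun x h => (h hab).elim
    · have := measure_eq_zero_iff_ae_notMem.1 (lebesgueOn_nontrivial_fiber_codim_two hV hab)
      filter_upwards [this] with x hx _ using hx
  filter_upwards [hnull] with x hx y hy z hz
  by_contra hyz
  obtain ⟨a, ha, b, hb, hab, h⟩ := exists_common_active_of_face hP h0 hdim hu hy hz hyz
  exact hx a ha b hb hab ⟨y, z, hyz, h⟩

/-- Let `u` be the component of `a + b` orthogonal to `V`. If `u ≠ 0`, then `⟪a + b, ·⟫ ≤ 2` puts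
both points of `P` in the face of the fiber in direction `u`, contradicting uniqueness off a null
set. If `u = 0`, the base lies in `⟪a + b, x⟫ = 2`, which is empty or a hyperplane of `V`. -/
theorem lebesgueOn_wideFiberBase [Nontrivial E] (hP : IsPolytope P) (h0 : (0 : E) ∈ interior P)
    (hbdd : Bornology.IsBounded (puffed 1 P))
    (hconv : IsStrictlyConvexBody (fiberBody V (puffed 1 P))) {a b : E}
    (ha : a ∈ facetNormals P) (hb : b ∈ facetNormals P) (hab : a ≠ b) :
    lebesgueOn V (wideFiberBase V P a b) = 0 := by
  classical
  have hKc := isCompact_puffed hbdd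
  by_cases hu : Vᗮ.orthogonalProjectionOnto (a + b) = 0
  · have hcV : a + b ∈ V := by
      rw [Submodule.orthogonalProjectionOnto_eq_zero_iff, Submodule.orthogonal_orthogonal] at hu
      exact hu
    have hsub : wideFiberBase V P a b ⊆ {x : V | ⟪(⟨a + b, hcV⟩ : V), x⟫_ℝ = 2} := by
      rintro _ ⟨y, -, z, -, -, rfl, -, hay, hby, -, -⟩
      change ⟪(⟨a + b, hcV⟩ : V), _⟫_ℝ = 2
      rw [inner_proj_of_mem, inner_add_left, hay, hby]
      norm_num
    by_cases hc : (⟨a + b, hcV⟩ : V) = 0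
    · refine measure_mono_null (hsub.trans fun x hx => ?_) (measure_empty (μ := lebesgueOn V))
      have hx : ⟪(⟨a + b, hcV⟩ : V), x⟫_ℝ = 2 := hx
      rw [hc, inner_zero_left] at hx
      norm_num at hx
    · exact measure_mono_null hsub (lebesgueOn_hyperplane hc 2)
  · have hae := ae_subsingleton_face_of_isStrictlyConvexBody hKc hconv hu
    rw [ae_restrict_iff' (isCompact_projImage hKc).measurableSet] at hae
    refine measure_mono_null ?_ (ae_iff.1 hae)
    rintro x ⟨y, hyP, z, hzP, hyz, hyx, hzx, hay, hby, haz, hbz⟩ hsub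
    have hsubset := subset_puffed_one hP h0
    have hface : ∀ p ∈ P, V.orthogonalProjectionOnto p = x → ⟪a, p⟫_ℝ = 1 → ⟪b, p⟫_ℝ = 1 →
        Vᗮ.orthogonalProjectionOnto p ∈
          faceInDirection (fiber V (puffed 1 P) x) (Vᗮ.orthogonalProjectionOnto (a + b)) := by
      intro p hp hpx hap hbp
      have hpe : (x : E) + (Vᗮ.orthogonalProjectionOnto p : Vᗮ) = p := by
        rw [← hpx]; exact proj_add_projOrth_eq p
      refine ⟨?_, fun q hq => ?_⟩
      · change _ ∈ puffed 1 P
        rw [hpe]; exact hsubset hp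
      · have h1 := (inClosedRegion_of_mem_puffed hP h0 hq).2 a (by simpa using ha) b
          (by simpa using hb) hab
        have h2 : ∀ v : Vᗮ, ⟪Vᗮ.orthogonalProjectionOnto (a + b), v⟫_ℝ = ⟪a + b, (v : E)⟫_ℝ :=
          fun v => by
            rw [real_inner_comm, inner_proj_of_mem, real_inner_comm]
        rw [h2, h2]
        have h3 : ⟪a + b, (x : E) + (Vᗮ.orthogonalProjectionOnto p : Vᗮ)⟫_ℝ = 2 := by
          rw [hpe, inner_add_left, hap, hbp]; norm_num
        rw [inner_add_right] at h3
        simp only [slack, inner_add_right] at h1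
        rw [inner_add_left a b (x : E)] at h3
        rw [inner_add_left a b (q : E)]
        linarith
    have hyz' := hsub ⟨y, hsubset hyP, hyx⟩ (hface y hyP hyx hay hby) (hface z hzP hzx haz hbz)
    refine hyz ?_
    rw [← proj_add_projOrth_eq (V := V) y, ← proj_add_projOrth_eq (V := V) z, hyx, hzx, hyz']

theorem not_isStrictlyConvexBody_fiberBody (hP : IsPolytope P) (h0 : (0 : E) ∈ interior P)
    (hbdd : Bornology.IsBounded (puffed 1 P))
    (hV : Module.finrank ℝ V + 3 ≤ Module.finrank ℝ E) :
    ¬ IsStrictlyConvexBody (fiberBody V (puffed 1 P)) := by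
  intro hconv
  have : Nontrivial E := Module.nontrivial_of_finrank_pos (R := ℝ) (by omega)
  obtain ⟨r, hr, hcover⟩ := exists_ball_subset_iUnion_wideFiberBase hP h0 hV
  have hfin := finite_facetNormals hP
  have hnull : ∀ᵐ x : V ∂lebesgueOn V, ∀ a ∈ facetNormals P, ∀ b ∈ facetNormals P, a ≠ b →
      x ∉ wideFiberBase V P a b := by
    refine (ae_ball_iff hfin.countable).2 fun a ha => (ae_ball_iff hfin.countable).2 fun b hb => ?_
    by_cases hab : a = b
    · exact ae_of_all _ fun x h => (h hab).elim
    · have := measure_eq_zero_iff_ae_notMem.1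
        (lebesgueOn_wideFiberBase hP h0 hbdd hconv ha hb hab)
      filter_upwards [this] with x hx _ using hx
  refine (Metric.measure_ball_pos (lebesgueOn V) 0 hr).ne' (measure_mono_null ?_ (ae_iff.1 hnull))
  intro x hx hall
  obtain ⟨a, ha, b, hb, hab, hmem⟩ := hcover x hx
  exact hall a ha b hb hab hmem

end Main

end PuffedFiber

theorem mainTheorem7 (n m : ℕ) (hn : 1 ≤ n) (hm : 2 ≤ m)
    (P : Set (EuclideanSpace ℝ (Fin (n + m))))
    (hP : PuffedFiber.IsPolytope P) (h0 : (0 : EuclideanSpace ℝ (Fin (n + m))) ∈ interior P)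
    (hbdd : Bornology.IsBounded (PuffedFiber.puffed 1 P))
    (V : Submodule ℝ (EuclideanSpace ℝ (Fin (n + m)))) (hV : Module.finrank ℝ V = n) :
    PuffedFiber.IsStrictlyConvexBody (PuffedFiber.fiberBody V (PuffedFiber.puffed 1 P)) ↔
      m = 2 := by
  have hE : Module.finrank ℝ (EuclideanSpace ℝ (Fin (n + m))) = n + m := finrank_euclideanSpace_fin
  constructor
  · intro h
    by_contra hm2
    exact PuffedFiber.not_isStrictlyConvexBody_fiberBody hP h0 hbdd (by omega) h
  · rintro rfl
    -- The ambient dimension `n + 2 ≥ 3` guarantees the three facets that the segment argument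
    -- needs.
    exact PuffedFiber.isStrictlyConvexBody_fiberBody_of_codim_two hP h0 hbdd (by omega) (by omega)
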